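/- Let $1\le N\le 3$, $\gamma>0$, $\omega\in\mathbb R$, $c\in\mathbb R^N$, and consider on $\mathbb R\times\mathbb R^N$ the system for complex-valued $u,v$ $$\begin{cases} i\partial_t u+\Delta u+\left(\tfrac19|u|^2+2|v|^2\right)u+\tfrac13\bar u^2v=0,\\ i\gamma\,\partial_t v+\Delta v+\left(9|v|^2+2|u|^2\right)v+\tfrac19u^3=0.\end{cases}$$ Suppose that one of the following conditions holds: (i) $N=2$ and $\omega\le 0$; (ii) $N=1$ or $N=3$, $\ \omega\le-\dfrac{|c|}{2N}$, and $|c|<\min\left\{2(4-N),\ \dfrac{6}{\gamma}(4-N)\right\}$. Then the system has no nonzero traveling solitary wave of the form $$\bigl(u(t,x),v(t,x)\bigr)=\bigl(e^{i\omega t}\phi(x-ct),\,e^{3i\omega t}\psi(x-ct)\bigr).$$ That is, there is no pair $(\phi,\psi)\in H^1(\mathbb R^N;\mathbb C)\times H^1(\mathbb R^N;\mathbb C)$ with $(\phi,\psi)\ne(0,0)$ for which this $(u,v)$ solves the system in the sense of distributions on $\mathbb R\times\mathbb R^N$. -/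

import Mathlib

open MeasureTheory
open scoped ComplexConjugate

noncomputable section

namespace NLSSystem

/-- Euclidean space `ℝ^N` with its Euclidean norm. -/
abbrev Space (N : ℕ) : Type := EuclideanSpace ℝ (Fin N)

/-- `g` is the weak partial derivative `∂ⱼ f` on `ℝ^N`, tested against `C_c^∞`. -/
def IsWeakPartialDeriv {N : ℕ} (j : Fin N) (f g : Space N → ℂ) : Prop :=
  ∀ χ : Space N → ℂ, ContDiff ℝ (⊤ : ℕ∞) χ → HasCompactSupport χ →
    ∫ x, f x * fderiv ℝ χ x (EuclideanSpace.single j 1) = - ∫ x, g x * χ x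

/-- `f ∈ H¹(ℝ^N; ℂ)`: `f` and all its first order weak derivatives are in `L²`. -/
def MemH1 {N : ℕ} (f : Space N → ℂ) : Prop :=
  MemLp f 2 volume ∧
    ∀ j : Fin N, ∃ g : Space N → ℂ, MemLp g 2 volume ∧ IsWeakPartialDeriv j f g

/-- The cubic term `(|u|²/9 + 2|v|²) u + ū² v / 3` of the first equation. -/
def nonlinU (u v : ℂ) : ℂ :=
  ((1 / 9 * ‖u‖ ^ 2 + 2 * ‖v‖ ^ 2 : ℝ) : ℂ) * u + 1 / 3 * (conj u) ^ 2 * v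

/-- The cubic term `(9|v|² + 2|u|²) v + u³ / 9` of the second equation. -/
def nonlinV (u v : ℂ) : ℂ :=
  ((9 * ‖v‖ ^ 2 + 2 * ‖u‖ ^ 2 : ℝ) : ℂ) * v + 1 / 9 * u ^ 3

/-- The time derivative `∂ₜ Φ` of a function on `ℝ × ℝ^N`. -/
def timeDeriv {N : ℕ} (Φ : ℝ × Space N → ℂ) (p : ℝ × Space N) : ℂ :=
  deriv (fun t : ℝ => Φ (t, p.2)) p.1

/-- The Laplacian `Δ Φ` in the space variable of a function on `ℝ × ℝ^N`. -/
def spaceLaplacian {N : ℕ} (Φ : ℝ × Space N → ℂ) (p : ℝ × Space N) : ℂ :=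
  Laplacian.laplacian (fun x : Space N => Φ (p.1, x)) p.2

/-- `w` solves `i a ∂ₜ w + Δ w + F = 0` on `ℝ × ℝ^N` in the sense of distributions. -/
def SolvesSchrodinger {N : ℕ} (a : ℝ) (w F : ℝ × Space N → ℂ) : Prop :=
  LocallyIntegrable w volume ∧ LocallyIntegrable F volume ∧
    ∀ Φ : ℝ × Space N → ℂ, ContDiff ℝ (⊤ : ℕ∞) Φ → HasCompactSupport Φ →
      ∫ p, (w p * (-(Complex.I * (a : ℂ) * timeDeriv Φ p) + spaceLaplacian Φ p)
        + F p * Φ p) = 0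

/-- `(u, v)` solves, on `ℝ × ℝ^N` and in the sense of distributions, the system
`i ∂ₜ u + Δ u + (|u|²/9 + 2|v|²) u + ū² v / 3 = 0`,
`i γ ∂ₜ v + Δ v + (9|v|² + 2|u|²) v + u³ / 9 = 0`. -/
def IsSolution {N : ℕ} (γ : ℝ) (u v : ℝ × Space N → ℂ) : Prop :=
  SolvesSchrodinger 1 u (fun p => nonlinU (u p) (v p)) ∧
    SolvesSchrodinger γ v (fun p => nonlinV (u p) (v p))

/-- The travelling profile `(t, x) ↦ e^{iωt} φ(x - c t)`. -/
def travelling {N : ℕ} (ω : ℝ) (c : Space N) (φ : Space N → ℂ) (p : ℝ × Space N) : ℂ :=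
  Complex.exp (Complex.I * (ω : ℂ) * (p.1 : ℂ)) * φ (p.2 - p.1 • c)

/-- `(φ, ψ)` are the profiles of a travelling solitary wave of frequency `ω` and velocity `c`:
both are in `H¹(ℝ^N; ℂ)` and `(e^{iωt} φ(x - ct), e^{3iωt} ψ(x - ct))` solves the system. -/
def IsTravellingSolitaryWave {N : ℕ} (γ ω : ℝ) (c : Space N) (φ ψ : Space N → ℂ) : Prop :=
  MemH1 φ ∧ MemH1 ψ ∧ IsSolution γ (travelling ω c φ) (travelling (3 * ω) c ψ)

end NLSSystem

end

/-!
A travelling wave gives profiles `φ, ψ ∈ H¹` solving, in the sense of distributions,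
`Δ φ - i c · ∇ φ - ω φ + F = 0` and `Δ ψ - i γ c · ∇ ψ - 3 γ ω ψ + G = 0`
(`solvesStationary_of_solvesSchrodinger`), where `(F, G)` is the gradient of a potential that is
homogeneous of degree four. Testing with `4 X · ∇ φ + (div X) φ` for a compactly supported vector
field `X` therefore removes the nonlinear terms altogether: together they form the divergence of
`X` times the potential (`integral_cubic`). Combining Pohozaev's and Nehari's identities *before*
letting `X → x` has the advantage that the potential need not be integrable on the whole space.
What remains is quadratic in `(φ, ∇ φ)` and `(ψ, ∇ ψ)`, and for `X → x` it becomes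
`∫ (4 - N) (|∇ φ|² + |∇ ψ|²) - N ω (|φ|² + 3 γ |ψ|²) - (N - 2) Im (φ c · ∇ φ̄ + γ ψ c · ∇ ψ̄) = 0`
(`integral_pohozaev`). Under either hypothesis the integrand is bounded below by a positive multiple
of `|∇ φ|² + |∇ ψ|²`, by Young's inequality (`le_pohozaevDensity`, `le_pohozaevDensity_two`); so the
gradients vanish, and a function of `L²(ℝ^N)` with zero gradient is zero.

The identity is justified for weak solutions without any `H²` regularity. It holds for the
mollifications `uₙ = ρₙ * φ`, which satisfy the mollified equation pointwise
(`SolvesStationary.mollify`, `integral_virial`), and involves only `uₙ`, `∇ uₙ` and the mollified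
nonlinearity, which converge in `L²` on balls. For the nonlinearity this uses that the
mollifications of an `H¹` function converge in `L⁶` on balls in dimension at most three
(`HasWeakGrad.lpConv_six`), which follows from the Gagliardo–Nirenberg–Sobolev inequality; cubic
expressions then converge in `L²`. The identities are proved for one vector field `X = ξ eₖ` at
a time, which suffices by linearity, and complex conjugates are treated as independent functions as
long as the functions involved are smooth.
-/

noncomputable section

namespace NLSSystem

/-! ### Partial derivatives and integration by parts -/

/-- The classical partial derivative `∂ⱼ f` on `ℝ^N`. -/
def pd {N : ℕ} (j : Fin N) (f : Space N → ℂ) (x : Space N) : ℂ :=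
  fderiv ℝ f x (EuclideanSpace.single j 1)

/-- Smooth complex functions on `ℝ^N`. -/
abbrev IsSmooth {N : ℕ} (f : Space N → ℂ) : Prop := ContDiff ℝ (⊤ : ℕ∞) f

/-- `f` is differentiable and `f'` is its partial derivative `∂ⱼ f`. Derivatives of long
polynomial expressions are assembled by composing such facts. -/
def HasPd {N : ℕ} (j : Fin N) (f f' : Space N → ℂ) : Prop :=
  Differentiable ℝ f ∧ ∀ x, pd j f x = f' x

variable {N : ℕ} {j k : Fin N} {f g f' g' : Space N → ℂ}

theorem IsSmooth.differentiable (hf : IsSmooth f) : Differentiable ℝ f :=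
  ContDiff.differentiable hf (by simp)

theorem IsSmooth.hasPd (hf : IsSmooth f) (j : Fin N) : HasPd j f (pd j f) :=
  ⟨hf.differentiable, fun _ => rfl⟩

theorem IsSmooth.pd (hf : IsSmooth f) (j : Fin N) : IsSmooth (pd j f) :=
  (hf.fderiv_right (m := (⊤ : ℕ∞)) (by simp)).clm_apply contDiff_const

theorem IsSmooth.mul (hf : IsSmooth f) (hg : IsSmooth g) : IsSmooth (fun x => f x * g x) :=
  ContDiff.mul hf hg

theorem IsSmooth.conj (hf : IsSmooth f) : IsSmooth (fun x => conj (f x)) :=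
  Complex.conjCLE.contDiff.comp hf

theorem HasPd.add (hf : HasPd j f f') (hg : HasPd j g g') :
    HasPd j (fun x => f x + g x) (fun x => f' x + g' x) := by
  refine ⟨hf.1.add hg.1, fun x => ?_⟩
  beta_reduce
  rw [← hf.2, ← hg.2, pd, fderiv_fun_add (hf.1 x) (hg.1 x)]
  rfl

theorem HasPd.sub (hf : HasPd j f f') (hg : HasPd j g g') :
    HasPd j (fun x => f x - g x) (fun x => f' x - g' x) := by
  refine ⟨hf.1.sub hg.1, fun x => ?_⟩
  beta_reduce
  rw [← hf.2, ← hg.2, pd, fderiv_fun_sub (hf.1 x) (hg.1 x)]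
  rfl

theorem HasPd.mul (hf : HasPd j f f') (hg : HasPd j g g') :
    HasPd j (fun x => f x * g x) (fun x => f' x * g x + f x * g' x) := by
  refine ⟨hf.1.mul hg.1, fun x => ?_⟩
  beta_reduce
  rw [← hf.2, ← hg.2, pd, fderiv_fun_mul (hf.1 x) (hg.1 x)]
  simp [pd]
  ring

theorem HasPd.const_mul (c : ℂ) (hf : HasPd j f f') :
    HasPd j (fun x => c * f x) (fun x => c * f' x) := by
  refine ⟨hf.1.const_mul c, fun x => ?_⟩
  beta_reduce
  rw [← hf.2, pd, fderiv_const_mul (hf.1 x)]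
  rfl

theorem HasPd.conj (hf : HasPd j f f') :
    HasPd j (fun x => conj (f x)) (fun x => conj (f' x)) := by
  have h : ∀ x, HasFDerivAt (fun x => conj (f x))
      ((Complex.conjCLE : ℂ →L[ℝ] ℂ).comp (fderiv ℝ f x)) x := fun x =>
    (Complex.conjCLE : ℂ →L[ℝ] ℂ).hasFDerivAt.comp x (hf.1 x).hasFDerivAt
  refine ⟨fun x => (h x).differentiableAt, fun x => ?_⟩
  beta_reduce
  rw [← hf.2, pd, (h x).fderiv]
  rfl

theorem pd_conj (hf : IsSmooth f) (j : Fin N) (x : Space N) :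
    pd j (fun x => conj (f x)) x = conj (pd j f x) :=
  (hf.hasPd j).conj.2 x

theorem pd_comm (hf : IsSmooth f) (j k : Fin N) (x : Space N) :
    pd j (pd k f) x = pd k (pd j f) x := by
  have hd : DifferentiableAt ℝ (fderiv ℝ f) x :=
    ((hf.fderiv_right (m := (⊤ : ℕ∞)) (by simp)).differentiable (by simp)) x
  have key : ∀ a b : Fin N, pd a (pd b f) x
      = fderiv ℝ (fderiv ℝ f) x (EuclideanSpace.single a 1) (EuclideanSpace.single b 1) := by
    intro a b
    have : pd b f = fun y => fderiv ℝ f y (EuclideanSpace.single b 1) := rfl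
    rw [this, pd, fderiv_clm_apply hd (differentiableAt_const _)]
    simp
  rw [key, key]
  have h2 : IsSymmSndFDerivAt ℝ f x :=
    (hf.contDiffAt).isSymmSndFDerivAt (by
      simpa using! WithTop.coe_le_coe.2 (le_top : (2 : ℕ∞) ≤ ⊤))
  exact h2 _ _

theorem hasCompactSupport_pd (hf : HasCompactSupport f) (j : Fin N) :
    HasCompactSupport (pd j f) :=
  hf.fderiv_apply (𝕜 := ℝ) _

theorem integral_pd_eq_zero (hf : IsSmooth f) (hc : HasCompactSupport f) (j : Fin N) :
    ∫ x, pd j f x = 0 := by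
  have h1 : Integrable f := hf.continuous.integrable_of_hasCompactSupport hc
  have h2 : Integrable (pd j f) :=
    (hf.pd j).continuous.integrable_of_hasCompactSupport (hasCompactSupport_pd hc j)
  have := integral_smul_fderiv_eq_neg_fderiv_smul_of_integrable (𝕜 := ℝ) (μ := volume)
    (f := fun _ : Space N => (1 : ℝ)) (g := f)
    (v := EuclideanSpace.single j 1) (by simp) (by simpa using! h2) (by simpa using h1)
    (by fun_prop) (fun x _ => hf.differentiable x)
  simpa using! this

theorem laplacian_eq_sum_pd (hf : IsSmooth f) (x : Space N) :
    Laplacian.laplacian f x = ∑ j, pd j (pd j f) x := by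
  rw [show Laplacian.laplacian f = _ from
    InnerProductSpace.laplacian_eq_iteratedFDeriv_orthonormalBasis f
      (EuclideanSpace.basisFun (Fin N) ℝ)]
  refine Finset.sum_congr rfl fun j _ => ?_
  have hd : DifferentiableAt ℝ (fderiv ℝ f) x :=
    ((hf.fderiv_right (m := (⊤ : ℕ∞)) (by simp)).differentiable (by simp)) x
  rw [iteratedFDeriv_two_apply]
  have : pd j f = fun y => fderiv ℝ f y (EuclideanSpace.single j 1) := rfl
  rw [this, pd, fderiv_clm_apply hd (differentiableAt_const _)]
  simp

/-! ### Virial identities for smooth functions -/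

section Virial

variable {N : ℕ} {j k : Fin N} {ξ u w v z : Space N → ℂ}

/-- The virial multiplier `4 ξ ∂ₖ u + ∂ₖ ξ u` attached to the vector field `ξ eₖ`. The relative
weight of its two terms is the one for which a quartic potential drops out. -/
def virial (k : Fin N) (ξ u : Space N → ℂ) (x : Space N) : ℂ :=
  4 * (ξ x * pd k u x) + pd k ξ x * u x

/-- The density left over when `∂ⱼ∂ⱼ u` is tested against the virial multiplier. -/
def kineticDensity (j k : Fin N) (ξ : Space N → ℂ) (u uj uk w wj wk : Space N → ℂ)
    (x : Space N) : ℂ :=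
  -4 * (pd j ξ x * (uj x * wk x + wj x * uk x)) + 2 * (pd k ξ x * (uj x * wj x))
    - pd j (pd k ξ) x * (uj x * w x + wj x * u x)

/-- The density left over when `i ∂ⱼ u` is tested against the virial multiplier. -/
def momentumDensity (j k : Fin N) (ξ : Space N → ℂ) (u uj uk w wj wk : Space N → ℂ)
    (x : Space N) : ℂ :=
  Complex.I * (-2 * (pd j ξ x * (u x * wk x - w x * uk x))
    + pd k ξ x * (u x * wj x - w x * uj x))

theorem IsSmooth.virial (hξ : IsSmooth ξ) (hu : IsSmooth u) (k : Fin N) :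
    IsSmooth (virial k ξ u) :=
  (contDiff_const.mul (hξ.mul (hu.pd k))).add ((hξ.pd k).mul hu)

theorem HasPd.virial (hξ : IsSmooth ξ) (hu : IsSmooth u) (j k : Fin N) :
    HasPd j (virial k ξ u) (fun x => 4 * (pd j ξ x * pd k u x + ξ x * pd j (pd k u) x)
      + (pd j (pd k ξ) x * u x + pd k ξ x * pd j u x)) :=
  (((hξ.hasPd j).mul ((hu.pd k).hasPd j)).const_mul 4).add (((hξ.pd k).hasPd j).mul (hu.hasPd j))

theorem hasCompactSupport_virial (hc : HasCompactSupport ξ) (k : Fin N) (u : Space N → ℂ) :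
    HasCompactSupport (virial k ξ u) :=
  ((hc.mul_right).mul_left).add ((hasCompactSupport_pd hc k).mul_right)

/-- Two smooth functions that differ by a divergence `∂ⱼ W₁ + ∂ₖ W₂` of compactly supported fields
have the same integral. -/
theorem integral_eq_of_sub_eq_pd {A B W₁ W₂ : Space N → ℂ} (hB : IsSmooth B)
    (hBc : HasCompactSupport B) (h₁ : IsSmooth W₁) (hc₁ : HasCompactSupport W₁) (h₂ : IsSmooth W₂)
    (hc₂ : HasCompactSupport W₂) (h : ∀ x, A x = B x + (pd j W₁ x + pd k W₂ x)) :
    ∫ x, A x = ∫ x, B x := by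
  have i1 := (h₁.pd j).continuous.integrable_of_hasCompactSupport (μ := volume)
    (hasCompactSupport_pd hc₁ j)
  have i2 := (h₂.pd k).continuous.integrable_of_hasCompactSupport (μ := volume)
    (hasCompactSupport_pd hc₂ k)
  have iB := hB.continuous.integrable_of_hasCompactSupport (μ := volume) hBc
  simp_rw [h]
  refine (integral_add iB (i1.add i2)).trans ?_
  rw [integral_add' i1 i2, integral_pd_eq_zero h₁ hc₁, integral_pd_eq_zero h₂ hc₂]
  simp

theorem isSmooth_kineticDensity (hξ : IsSmooth ξ) (hu : IsSmooth u) (hw : IsSmooth w)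
    (j k : Fin N) :
    IsSmooth (kineticDensity j k ξ u (pd j u) (pd k u) w (pd j w) (pd k w)) := by
  have := hξ.pd j
  have := hξ.pd k
  have := (hξ.pd k).pd j
  have := hu.pd j
  have := hu.pd k
  have := hw.pd j
  have := hw.pd k
  unfold IsSmooth at *
  unfold kineticDensity
  fun_prop

theorem hasCompactSupport_kineticDensity (hc : HasCompactSupport ξ) (j k : Fin N)
    (u uj uk w wj wk : Space N → ℂ) :
    HasCompactSupport (kineticDensity j k ξ u uj uk w wj wk) :=
  (((hasCompactSupport_pd hc j).mul_right.mul_left).add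
    ((hasCompactSupport_pd hc k).mul_right.mul_left)).sub
    ((hasCompactSupport_pd (hasCompactSupport_pd hc k) j).mul_right)

theorem isSmooth_momentumDensity (hξ : IsSmooth ξ) (hu : IsSmooth u) (hw : IsSmooth w)
    (j k : Fin N) :
    IsSmooth (momentumDensity j k ξ u (pd j u) (pd k u) w (pd j w) (pd k w)) := by
  have := hξ.pd j
  have := hξ.pd k
  have := hu.pd j
  have := hu.pd k
  have := hw.pd j
  have := hw.pd k
  unfold IsSmooth at *
  unfold momentumDensity
  fun_prop

theorem hasCompactSupport_momentumDensity (hc : HasCompactSupport ξ) (j k : Fin N)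
    (u uj uk w wj wk : Space N → ℂ) :
    HasCompactSupport (momentumDensity j k ξ u uj uk w wj wk) :=
  (((hasCompactSupport_pd hc j).mul_right.mul_left).add
    ((hasCompactSupport_pd hc k).mul_right)).mul_left

/-- Testing the second derivatives `∂ⱼ∂ⱼ u` against the virial multiplier of `ξ eₖ`; `w` plays the
role of the complex conjugate of `u`. Second derivatives of `u` cancel because
`∂ⱼ u ∂ₖ∂ⱼ w + ∂ⱼ w ∂ₖ∂ⱼ u = ∂ₖ (∂ⱼ u ∂ⱼ w)`, which is integrated by parts once more. -/
theorem integral_kinetic (hξ : IsSmooth ξ) (hc : HasCompactSupport ξ) (hu : IsSmooth u)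
    (hw : IsSmooth w) (j k : Fin N) :
    ∫ x, (pd j (pd j u) x * virial k ξ w x + pd j (pd j w) x * virial k ξ u x)
      = ∫ x, kineticDensity j k ξ u (pd j u) (pd k u) w (pd j w) (pd k w) x := by
  refine integral_eq_of_sub_eq_pd (j := j) (k := k)
    (W₁ := fun x => pd j u x * virial k ξ w x + pd j w x * virial k ξ u x)
    (W₂ := fun x => -4 * (ξ x * (pd j u x * pd j w x)))
    (isSmooth_kineticDensity hξ hu hw j k) (hasCompactSupport_kineticDensity hc ..)
    (((hu.pd j).mul (hξ.virial hw k)).add ((hw.pd j).mul (hξ.virial hu k)))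
    ((hasCompactSupport_virial hc k w).mul_left.add (hasCompactSupport_virial hc k u).mul_left)
    (contDiff_const.mul (hξ.mul ((hu.pd j).mul (hw.pd j)))) hc.mul_right.mul_left fun x => ?_
  rw [((((hu.pd j).hasPd j).mul (HasPd.virial hξ hw j k)).add
      (((hw.pd j).hasPd j).mul (HasPd.virial hξ hu j k))).2 x,
    (((hξ.hasPd k).mul (((hu.pd j).hasPd k).mul ((hw.pd j).hasPd k))).const_mul (-4)).2 x]
  simp only [pd_comm hu k j, pd_comm hw k j, kineticDensity, virial]
  ring

/-- Testing the drift `i ∂ⱼ u` against the virial multiplier of `ξ eₖ`. The expression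
`∂ⱼ u ∂ₖ w - ∂ⱼ w ∂ₖ u` is half the curl of the current `u ∇ w - w ∇ u`, so that one integration by
parts reduces the order. -/
theorem integral_momentum (hξ : IsSmooth ξ) (hc : HasCompactSupport ξ) (hu : IsSmooth u)
    (hw : IsSmooth w) (j k : Fin N) :
    ∫ x, (Complex.I * pd j u x * virial k ξ w x - Complex.I * pd j w x * virial k ξ u x)
      = ∫ x, momentumDensity j k ξ u (pd j u) (pd k u) w (pd j w) (pd k w) x := by
  have hm : ∀ l, IsSmooth (fun x => u x * pd l w x - w x * pd l u x) := fun l =>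
    (hu.mul (hw.pd l)).sub (hw.mul (hu.pd l))
  have hd : ∀ l i, HasPd i (fun x => u x * pd l w x - w x * pd l u x) _ := fun l i =>
    ((hu.hasPd i).mul ((hw.pd l).hasPd i)).sub ((hw.hasPd i).mul ((hu.pd l).hasPd i))
  refine integral_eq_of_sub_eq_pd (j := j) (k := k)
    (W₁ := fun x => (2 * Complex.I) * (ξ x * (u x * pd k w x - w x * pd k u x)))
    (W₂ := fun x => (-2 * Complex.I) * (ξ x * (u x * pd j w x - w x * pd j u x)))
    (isSmooth_momentumDensity hξ hu hw j k) (hasCompactSupport_momentumDensity hc ..)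
    (contDiff_const.mul (hξ.mul (hm k))) hc.mul_right.mul_left
    (contDiff_const.mul (hξ.mul (hm j))) hc.mul_right.mul_left fun x => ?_
  rw [(((hξ.hasPd j).mul (hd k j)).const_mul (2 * Complex.I)).2 x,
    (((hξ.hasPd k).mul (hd j k)).const_mul (-2 * Complex.I)).2 x]
  simp only [pd_comm hu k j, pd_comm hw k j, momentumDensity, virial]
  ring

theorem integral_mass (hξ : IsSmooth ξ) (hc : HasCompactSupport ξ) (hu : IsSmooth u)
    (hw : IsSmooth w) (k : Fin N) :
    ∫ x, (u x * virial k ξ w x + w x * virial k ξ u x)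
      = ∫ x, -2 * (pd k ξ x * (u x * w x)) := by
  refine integral_eq_of_sub_eq_pd (j := k) (k := k)
    (W₁ := fun x => 4 * (ξ x * (u x * w x))) (W₂ := fun _ => 0)
    (contDiff_const.mul ((hξ.pd k).mul (hu.mul hw)))
    (hasCompactSupport_pd hc k).mul_right.mul_left
    (contDiff_const.mul (hξ.mul (hu.mul hw))) hc.mul_right.mul_left
    contDiff_const HasCompactSupport.zero fun x => ?_
  rw [(((hξ.hasPd k).mul ((hu.hasPd k).mul (hw.hasPd k))).const_mul 4).2 x]
  simp only [virial, pd]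
  simp
  ring

/-- The cubic terms are the gradient of a quartic potential, so that they do not contribute to the
virial identity. Here `w` and `z` play the roles of the conjugates of `u` and `v`. -/
theorem integral_cubic (hξ : IsSmooth ξ) (hc : HasCompactSupport ξ) (hu : IsSmooth u)
    (hw : IsSmooth w) (hv : IsSmooth v) (hz : IsSmooth z) (k : Fin N) :
    ∫ x, (((1 / 9 * (u x * w x) + 2 * (v x * z x)) * u x + 1 / 3 * w x ^ 2 * v x) * virial k ξ w x
      + ((1 / 9 * (u x * w x) + 2 * (v x * z x)) * w x + 1 / 3 * u x ^ 2 * z x) * virial k ξ u x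
      + (((9 * (v x * z x) + 2 * (u x * w x)) * v x + 1 / 9 * u x ^ 3) * virial k ξ z x
      + ((9 * (v x * z x) + 2 * (u x * w x)) * z x + 1 / 9 * w x ^ 3) * virial k ξ v x)) = 0 := by
  -- the derivative of the potential `(u w)² / 36 + 9 (v z)² / 4 + u w v z + (w³ v + u³ z) / 18`
  have hG := (((((hu.hasPd k).mul (hu.hasPd k)).mul
    ((hw.hasPd k).mul (hw.hasPd k))).const_mul (1 / 36)).add
    ((((hv.hasPd k).mul (hv.hasPd k)).mul ((hz.hasPd k).mul (hz.hasPd k))).const_mul (9 / 4))).add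
    ((((hu.hasPd k).mul (hw.hasPd k)).mul ((hv.hasPd k).mul (hz.hasPd k))).add
    ((((hw.hasPd k).mul ((hw.hasPd k).mul ((hw.hasPd k).mul (hv.hasPd k)))).add
    ((hu.hasPd k).mul ((hu.hasPd k).mul ((hu.hasPd k).mul (hz.hasPd k))))).const_mul (1 / 18)))
  have key := ((hξ.hasPd k).mul hG).const_mul 8
  have h0 := integral_eq_of_sub_eq_pd (j := k) (k := k) (B := fun _ => 0) (W₂ := fun _ => 0)
    (W₁ := fun x => 8 * (ξ x * (((1 / 36) * ((u x * u x) * (w x * w x))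
      + (9 / 4) * ((v x * v x) * (z x * z x))) + ((u x * w x) * (v x * z x)
      + (1 / 18) * (w x * (w x * (w x * v x)) + u x * (u x * (u x * z x)))))))
    (A := fun x => (((1 / 9 * (u x * w x) + 2 * (v x * z x)) * u x + 1 / 3 * w x ^ 2 * v x)
        * virial k ξ w x
      + ((1 / 9 * (u x * w x) + 2 * (v x * z x)) * w x + 1 / 3 * u x ^ 2 * z x) * virial k ξ u x
      + (((9 * (v x * z x) + 2 * (u x * w x)) * v x + 1 / 9 * u x ^ 3) * virial k ξ z x
      + ((9 * (v x * z x) + 2 * (u x * w x)) * z x + 1 / 9 * w x ^ 3) * virial k ξ v x)))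
    contDiff_const HasCompactSupport.zero ?_ hc.mul_right.mul_left contDiff_const
    HasCompactSupport.zero ?_
  · simpa using h0
  · unfold IsSmooth at *
    fun_prop
  · intro x
    rw [key.2 x]
    simp only [virial, pd]
    simp
    ring

end Virial

/-! ### Convergence in `L^p` of products -/

section LpConv

open Filter Topology
open scoped ENNReal

variable {α : Type*} [MeasurableSpace α] {μ : Measure α} {p q r : ℝ≥0∞}
  {a b : ℕ → α → ℂ} {a' b' : α → ℂ}

/-- `aₙ → a'` in `L^p(μ)`, all functions being in `L^p(μ)`. -/
structure LpConv (p : ℝ≥0∞) (μ : Measure α) (a : ℕ → α → ℂ) (a' : α → ℂ) : Prop where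
  memLp : ∀ n, MemLp (a n) p μ
  memLp_lim : MemLp a' p μ
  tendsto : Tendsto (fun n => eLpNorm (a n - a') p μ) atTop (𝓝 0)

namespace LpConv

theorem const (h : MemLp a' p μ) : LpConv p μ (fun _ => a') a' :=
  ⟨fun _ => h, h, by simp⟩

theorem add (hp : 1 ≤ p) (ha : LpConv p μ a a') (hb : LpConv p μ b b') :
    LpConv p μ (fun n x => a n x + b n x) (fun x => a' x + b' x) := by
  refine ⟨fun n => (ha.memLp n).add (hb.memLp n), ha.memLp_lim.add hb.memLp_lim, ?_⟩
  have h := ha.tendsto.add hb.tendsto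
  rw [add_zero] at h
  refine tendsto_of_tendsto_of_tendsto_of_le_of_le tendsto_const_nhds h (fun _ => zero_le)
    fun n => ?_
  have e : (fun x => a n x + b n x) - (fun x => a' x + b' x) = (a n - a') + (b n - b') := by
    ext x
    simp only [Pi.sub_apply, Pi.add_apply]
    ring
  simp only [e]
  exact eLpNorm_add_le ((ha.memLp n).sub ha.memLp_lim).1 ((hb.memLp n).sub hb.memLp_lim).1 hp

theorem mul [hpqr : ENNReal.HolderTriple p q r] (hr : 1 ≤ r) (ha : LpConv p μ a a')
    (hb : LpConv q μ b b') : LpConv r μ (fun n x => a n x * b n x) (fun x => a' x * b' x) := by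
  refine ⟨fun n => (hb.memLp n).mul' (ha.memLp n), hb.memLp_lim.mul' ha.memLp_lim, ?_⟩
  have h1 := ENNReal.Tendsto.mul ha.tendsto (by simp) hb.tendsto (by simp)
  have h2 := ENNReal.Tendsto.mul_const (b := eLpNorm b' q μ) ha.tendsto
    (Or.inr hb.memLp_lim.eLpNorm_ne_top)
  have h3 := ENNReal.Tendsto.const_mul (a := eLpNorm a' p μ) hb.tendsto
    (Or.inr ha.memLp_lim.eLpNorm_ne_top)
  have h := (h1.add h2).add h3
  simp only [mul_zero, zero_mul, add_zero] at h
  refine tendsto_of_tendsto_of_tendsto_of_le_of_le tendsto_const_nhds h (fun _ => zero_le)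
    fun n => ?_
  have da := (ha.memLp n).sub ha.memLp_lim
  have db := (hb.memLp n).sub hb.memLp_lim
  have e : (fun x => a n x * b n x) - (fun x => a' x * b' x)
      = ((a n - a') • (b n - b') + (a n - a') • b') + a' • (b n - b') := by
    ext x
    simp only [Pi.sub_apply, Pi.add_apply, smul_eq_mul, Pi.mul_apply]
    ring
  simp only [e]
  have m1 : MemLp ((a n - a') • (b n - b')) r μ := db.smul da
  have m2 : MemLp ((a n - a') • b') r μ := hb.memLp_lim.smul da
  have m3 : MemLp (a' • (b n - b')) r μ := db.smul ha.memLp_lim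
  refine (eLpNorm_add_le (m1.add m2).1 m3.1 hr).trans (add_le_add
    ((eLpNorm_add_le m1.1 m2.1 hr).trans (add_le_add ?_ ?_)) ?_)
  · exact eLpNorm_smul_le_mul_eLpNorm db.1 da.1
  · exact eLpNorm_smul_le_mul_eLpNorm hb.memLp_lim.1 da.1
  · exact eLpNorm_smul_le_mul_eLpNorm db.1 ha.memLp_lim.1

theorem bdd_mul (hp : 1 ≤ p) {m : α → ℂ} (hm : MemLp m ∞ μ) (ha : LpConv p μ a a') :
    LpConv p μ (fun n x => m x * a n x) (fun x => m x * a' x) :=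
  (const hm).mul hp ha

theorem const_mul (c : ℂ) (ha : LpConv p μ a a') :
    LpConv p μ (fun n x => c * a n x) (fun x => c * a' x) := by
  refine ⟨fun n => (ha.memLp n).const_mul c, ha.memLp_lim.const_mul c, ?_⟩
  have h := ENNReal.Tendsto.const_mul (a := ‖c‖ₑ) ha.tendsto (Or.inr (by simp))
  rw [mul_zero] at h
  refine h.congr fun n => ?_
  rw [← eLpNorm_const_smul]
  congr 1
  ext x
  simp [mul_sub]

theorem sub (hp : 1 ≤ p) (ha : LpConv p μ a a') (hb : LpConv p μ b b') :
    LpConv p μ (fun n x => a n x - b n x) (fun x => a' x - b' x) := by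
  simpa [sub_eq_add_neg] using ha.add hp (hb.const_mul (-1))

theorem sum (hp : 1 ≤ p) {ι : Type*} (s : Finset ι) {a : ι → ℕ → α → ℂ} {a' : ι → α → ℂ}
    (h : ∀ i, LpConv p μ (a i) (a' i)) :
    LpConv p μ (fun n x => ∑ i ∈ s, a i n x) (fun x => ∑ i ∈ s, a' i x) := by
  classical
  induction s using Finset.induction_on with
  | empty => simpa using const (p := p) (μ := μ) (a' := fun _ => (0 : ℂ)) MemLp.zero'
  | insert i s hi ih => simpa [Finset.sum_insert hi] using (h i).add hp ih

theorem star (ha : LpConv p μ a a') :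
    LpConv p μ (fun n x => conj (a n x)) (fun x => conj (a' x)) := by
  refine ⟨fun n => MemLp.star (ha.memLp n), MemLp.star ha.memLp_lim, ha.tendsto.congr fun n => ?_⟩
  refine eLpNorm_congr_norm_ae (ae_of_all _ fun x => ?_)
  simp only [Pi.sub_apply]
  rw [← map_sub, RCLike.norm_conj]

theorem tendsto_integral (ha : LpConv 1 μ a a') :
    Tendsto (fun n => ∫ x, a n x ∂μ) atTop (𝓝 (∫ x, a' x ∂μ)) :=
  tendsto_integral_of_L1' _ ha.memLp_lim.1
    (Eventually.of_forall fun n => memLp_one_iff_integrable.1 (ha.memLp n)) ha.tendsto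

theorem congr (ha : LpConv p μ a a') (h : ∀ n, b n =ᵐ[μ] a n) (h' : b' =ᵐ[μ] a') :
    LpConv p μ b b' :=
  ⟨fun n => (ha.memLp n).ae_eq (h n).symm, ha.memLp_lim.ae_eq h'.symm,
    ha.tendsto.congr fun n => eLpNorm_congr_ae ((h n).symm.sub h'.symm)⟩

end LpConv

end LpConv

/-! ### Mollification -/

section Mollify

open Filter Topology
open scoped ENNReal Convolution

variable {N : ℕ} {ρ h h₁ h₂ : Space N → ℂ}

/-- The convolution `ρ * h`. -/
def conv (ρ h : Space N → ℂ) (x : Space N) : ℂ := ∫ y, ρ (x - y) * h y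

theorem conv_eq_convolution (ρ h : Space N → ℂ) :
    conv ρ h = ρ ⋆[ContinuousLinearMap.mul ℝ ℂ] h := by
  ext x
  rw [convolution_eq_swap]
  rfl

theorem integrable_conv (hρ : Continuous ρ) (hc : HasCompactSupport ρ)
    (hh : LocallyIntegrable h) (x : Space N) : Integrable (fun y => ρ (x - y) * h y) := by
  have h1 := (hc.convolutionExists_left (ContinuousLinearMap.mul ℝ ℂ) hρ hh (μ := volume)) x
  exact h1.integrable_swap

theorem conv_sub (hρ : Continuous ρ) (hc : HasCompactSupport ρ) (hh₁ : LocallyIntegrable h₁)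
    (hh₂ : LocallyIntegrable h₂) : conv ρ (h₁ - h₂) = conv ρ h₁ - conv ρ h₂ := by
  ext x
  simp only [conv, Pi.sub_apply, mul_sub]
  exact integral_sub (integrable_conv hρ hc hh₁ x) (integrable_conv hρ hc hh₂ x)

theorem isSmooth_conv (hρ : IsSmooth ρ) (hc : HasCompactSupport ρ) (hh : LocallyIntegrable h) :
    IsSmooth (conv ρ h) := by
  rw [conv_eq_convolution]
  exact hc.contDiff_convolution_left _ hρ hh

theorem pd_conv (hρ : IsSmooth ρ) (hc : HasCompactSupport ρ) (hh : LocallyIntegrable h)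
    (j : Fin N) (x : Space N) : pd j (conv ρ h) x = conv (pd j ρ) h x := by
  have h1 := (hc.hasFDerivAt_convolution_left (ContinuousLinearMap.mul ℝ ℂ) (hρ.of_le (by simp))
    hh x).fderiv
  have hf : Continuous (fderiv ℝ ρ) := hρ.continuous_fderiv (by simp)
  have h2 := (hc.fderiv (𝕜 := ℝ)).convolutionExists_left
    ((ContinuousLinearMap.mul ℝ ℂ).precompL (Space N)) hf hh (μ := volume) x
  rw [pd, conv_eq_convolution, h1, conv_eq_convolution, convolution_def, convolution_def,
    ContinuousLinearMap.integral_apply h2]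
  rfl

theorem isSmooth_reflect (hρ : IsSmooth ρ) (x : Space N) : IsSmooth (fun y => ρ (x - y)) :=
  hρ.comp (contDiff_const.sub contDiff_id)

theorem hasCompactSupport_reflect (hc : HasCompactSupport ρ) (x : Space N) :
    HasCompactSupport (fun y => ρ (x - y)) :=
  hc.comp_homeomorph (Homeomorph.subLeft x)

theorem pd_reflect (hρ : IsSmooth ρ) (j : Fin N) (x y : Space N) :
    pd j (fun y => ρ (x - y)) y = -pd j ρ (x - y) := by
  have h1 : HasFDerivAt (fun y : Space N => x - y) (-ContinuousLinearMap.id ℝ (Space N)) y :=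
    (hasFDerivAt_id y).const_sub x
  have h2 := (hρ.differentiable (x - y)).hasFDerivAt.comp y h1
  have h3 : pd j (fun y => ρ (x - y)) y = _ := congrArg (· (EuclideanSpace.single j 1)) h2.fderiv
  rw [h3]
  simp [pd]

/-- A weak derivative turns into a classical one after mollification. -/
theorem pd_conv_of_weak {φ g : Space N → ℂ} {j : Fin N} (hρ : IsSmooth ρ)
    (hc : HasCompactSupport ρ) (hφ : LocallyIntegrable φ) (hg : IsWeakPartialDeriv j φ g) :
    pd j (conv ρ φ) = conv ρ g := by
  ext x
  rw [pd_conv hρ hc hφ]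
  have h1 := hg _ (isSmooth_reflect hρ x) (hasCompactSupport_reflect hc x)
  have h2 : ∀ y, fderiv ℝ (fun y => ρ (x - y)) y (EuclideanSpace.single j 1)
      = -pd j ρ (x - y) := pd_reflect hρ j x
  simp only [h2, mul_neg, integral_neg, neg_inj] at h1
  simp only [conv]
  simp only [mul_comm] at h1 ⊢
  exact h1

/-- A bump of integral one, supported in the ball of radius `1 / (n + 1)`. -/
def bump (N n : ℕ) : ContDiffBump (0 : Space N) where
  rIn := 1 / (2 * ((n : ℝ) + 1))
  rOut := 1 / ((n : ℝ) + 1)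
  rIn_pos := by positivity
  rIn_lt_rOut := by
    apply one_div_lt_one_div_of_lt <;> linarith [n.cast_nonneg (α := ℝ)]

/-- The standard mollifiers. -/
def mollifier (N n : ℕ) (x : Space N) : ℂ := ((bump N n).normed volume x : ℝ)

theorem isSmooth_mollifier (N n : ℕ) : IsSmooth (mollifier N n) :=
  Complex.ofRealCLM.contDiff.comp (bump N n).contDiff_normed

theorem hasCompactSupport_mollifier (N n : ℕ) : HasCompactSupport (mollifier N n) :=
  (bump N n).hasCompactSupport_normed.comp_left (g := fun r : ℝ => (r : ℂ)) (by simp)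

theorem mollifier_eq_zero {n : ℕ} {x : Space N} (hx : 1 / ((n : ℝ) + 1) ≤ ‖x‖) :
    mollifier N n x = 0 := by
  have : x ∉ Function.support ((bump N n).normed volume) := by
    rw [ContDiffBump.support_normed_eq]
    simpa [bump] using hx
  rw [Function.notMem_support] at this
  simp [mollifier, this]

theorem lintegral_enorm_mollifier (N n : ℕ) : ∫⁻ x, ‖mollifier N n x‖ₑ = 1 := by
  have h1 : ∀ x, ‖mollifier N n x‖ₑ = ENNReal.ofReal ((bump N n).normed volume x) := by
    intro x
    rw [← ofReal_norm, mollifier, Complex.norm_real,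
      Real.norm_of_nonneg ((bump N n).nonneg_normed x)]
  simp_rw [h1]
  rw [← ofReal_integral_eq_lintegral_ofReal (bump N n).integrable_normed
    (ae_of_all _ (bump N n).nonneg_normed), (bump N n).integral_normed, ENNReal.ofReal_one]

theorem conv_mollifier_eq (n : ℕ) (h : Space N → ℂ) :
    conv (mollifier N n) h
      = ((bump N n).normed volume) ⋆[ContinuousLinearMap.lsmul ℝ ℝ, volume] h := by
  ext x
  rw [convolution_lsmul_swap]
  simp [conv, mollifier]

theorem tendsto_rOut (N : ℕ) : Tendsto (fun n => (bump N n).rOut) atTop (𝓝 0) :=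
  tendsto_one_div_add_atTop_nhds_zero_nat

/-- The Cauchy–Schwarz inequality for the probability density `mollifier N n`. -/
theorem enorm_conv_sq_le (n : ℕ) (hh : StronglyMeasurable h) (x : Space N) :
    ‖conv (mollifier N n) h x‖ₑ ^ (2 : ℝ)
      ≤ ∫⁻ t, ‖mollifier N n t‖ₑ * ‖h (x - t)‖ₑ ^ (2 : ℝ) := by
  have hm := (isSmooth_mollifier N n).continuous
  have h0 : conv (mollifier N n) h x = ∫ t, mollifier N n t * h (x - t) := by
    rw [conv_eq_convolution, convolution_def]
    rfl
  have hx : Measurable (fun t => h (x - t)) :=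
    hh.measurable.comp (measurable_const.sub measurable_id)
  have hmm : Measurable (fun t => ‖mollifier N n t‖ₑ) := hm.measurable.enorm
  have h1 : ‖conv (mollifier N n) h x‖ₑ
      ≤ ∫⁻ t, (‖mollifier N n t‖ₑ * ‖h (x - t)‖ₑ ^ (2 : ℝ)) ^ (1 / 2 : ℝ)
        * ‖mollifier N n t‖ₑ ^ (1 / 2 : ℝ) := by
    rw [h0]
    refine (enorm_integral_le_lintegral_enorm _).trans (le_of_eq (lintegral_congr fun t => ?_))
    rw [enorm_mul, ENNReal.mul_rpow_of_nonneg _ _ (by norm_num), ← ENNReal.rpow_mul, mul_right_comm,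
      ← ENNReal.rpow_add_of_nonneg _ _ (by norm_num) (by norm_num)]
    norm_num
  have h2 := ENNReal.lintegral_mul_norm_pow_le (μ := volume)
    (f := fun t => ‖mollifier N n t‖ₑ * ‖h (x - t)‖ₑ ^ (2 : ℝ)) (g := fun t => ‖mollifier N n t‖ₑ)
    (hmm.mul (hx.enorm.pow_const _)).aemeasurable hmm.aemeasurable (p := 1 / 2) (q := 1 / 2)
    (by norm_num) (by norm_num) (by norm_num)
  rw [lintegral_enorm_mollifier, ENNReal.one_rpow, mul_one] at h2
  calc _ ≤ ((∫⁻ t, ‖mollifier N n t‖ₑ * ‖h (x - t)‖ₑ ^ (2 : ℝ)) ^ (1 / 2 : ℝ)) ^ (2 : ℝ) :=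
        ENNReal.rpow_le_rpow (h1.trans h2) (by norm_num)
    _ = _ := by rw [← ENNReal.rpow_mul]; norm_num

theorem conv_congr_ae (ρ : Space N → ℂ) (h : h₁ =ᵐ[volume] h₂) : conv ρ h₁ = conv ρ h₂ := by
  ext x
  exact integral_congr_ae (h.mono fun y hy => by simp only [hy])

/-- Mollification is a contraction of `L²`. -/
theorem eLpNorm_conv_le (n : ℕ) (hh : AEStronglyMeasurable h) :
    eLpNorm (conv (mollifier N n) h) 2 volume ≤ eLpNorm h 2 volume := by
  wlog hs : StronglyMeasurable h generalizing h
  · rw [conv_congr_ae _ hh.ae_eq_mk, eLpNorm_congr_ae hh.ae_eq_mk]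
    exact this hh.stronglyMeasurable_mk.aestronglyMeasurable hh.stronglyMeasurable_mk
  rw [eLpNorm_eq_lintegral_rpow_enorm_toReal (by simp) (by simp),
    eLpNorm_eq_lintegral_rpow_enorm_toReal (by simp) (by simp)]
  refine ENNReal.rpow_le_rpow ?_ (by positivity)
  simp only [ENNReal.toReal_ofNat]
  have hm : Measurable (fun p : Space N × Space N =>
      ‖mollifier N n p.2‖ₑ * ‖h (p.1 - p.2)‖ₑ ^ (2 : ℝ)) :=
    ((isSmooth_mollifier N n).continuous.measurable.comp measurable_snd).enorm.mul
      ((hs.measurable.comp (measurable_fst.sub measurable_snd)).enorm.pow_const _)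
  calc ∫⁻ x, ‖conv (mollifier N n) h x‖ₑ ^ (2 : ℝ)
      ≤ ∫⁻ x, ∫⁻ t, ‖mollifier N n t‖ₑ * ‖h (x - t)‖ₑ ^ (2 : ℝ) :=
        lintegral_mono fun x => enorm_conv_sq_le n hs x
    _ = ∫⁻ t, ∫⁻ x, ‖mollifier N n t‖ₑ * ‖h (x - t)‖ₑ ^ (2 : ℝ) :=
        lintegral_lintegral_swap hm.aemeasurable
    _ = ∫⁻ t, ‖mollifier N n t‖ₑ * ∫⁻ x, ‖h x‖ₑ ^ (2 : ℝ) := by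
        refine lintegral_congr fun t => ?_
        rw [lintegral_const_mul' _ _ (by simp)]
        congr 1
        exact lintegral_sub_right_eq_self (fun x => ‖h x‖ₑ ^ (2 : ℝ)) t
    _ = _ := by
        rw [lintegral_mul_const _ (isSmooth_mollifier N n).continuous.measurable.enorm,
          lintegral_enorm_mollifier, one_mul]

theorem memLp_conv (n : ℕ) (hh : MemLp h 2 volume) :
    MemLp (conv (mollifier N n) h) 2 volume :=
  ⟨(isSmooth_conv (isSmooth_mollifier N n) (hasCompactSupport_mollifier N n)
    (hh.locallyIntegrable (by norm_num))).continuous.aestronglyMeasurable,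
    (eLpNorm_conv_le n hh.1).trans_lt hh.2⟩

/-- For `h ∈ C_c` the convergence is uniform, with supports in a fixed ball. -/
theorem tendsto_conv_of_continuous (hh : Continuous h) (hc : HasCompactSupport h) :
    Tendsto (fun n => eLpNorm (conv (mollifier N n) h - h) 2 volume) atTop (𝓝 0) := by
  obtain ⟨R, hR⟩ := hc.isCompact.isBounded.subset_closedBall (0 : Space N)
  have huc := hc.uniformContinuous_of_continuous hh
  set V : ℝ≥0∞ := (volume.restrict (Metric.closedBall (0 : Space N) (R + 1)) Set.univ)
    ^ ((2 : ℝ≥0∞).toReal⁻¹) with hV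
  have hVt : V ≠ ∞ := by
    refine ENNReal.rpow_ne_top_of_nonneg (by positivity) ?_
    rw [Measure.restrict_apply_univ]
    exact measure_closedBall_lt_top.ne
  have hh0 : ∀ y : Space N, R < ‖y‖ → h y = 0 := by
    intro y hy
    by_contra hne
    have := hR (subset_tsupport _ (Function.mem_support.2 hne))
    rw [mem_closedBall_zero_iff] at this
    linarith
  have hsupp : ∀ n (x : Space N), x ∉ Metric.closedBall (0 : Space N) (R + 1) →
      (conv (mollifier N n) h - h) x = 0 := by
    intro n x hx
    rw [mem_closedBall_zero_iff, not_le] at hx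
    have h1 : conv (mollifier N n) h x = 0 := by
      refine integral_eq_zero_of_ae (ae_of_all _ fun y => ?_)
      by_cases hy : R < ‖y‖
      · simp [hh0 y hy]
      · have : 1 / ((n : ℝ) + 1) ≤ ‖x - y‖ := by
          have h2 : 1 / ((n : ℝ) + 1) ≤ 1 := by
            rw [div_le_one (by positivity)]
            linarith [n.cast_nonneg (α := ℝ)]
          have := norm_sub_norm_le x y
          linarith
        simp [mollifier_eq_zero this]
    simp [h1, hh0 x (by linarith)]
  have key : ∀ ε > 0, ∀ᶠ n in atTop,
      eLpNorm (conv (mollifier N n) h - h) 2 volume ≤ V * ENNReal.ofReal ε := by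
    intro ε hε
    obtain ⟨δ, hδ, hd⟩ := Metric.uniformContinuous_iff.1 huc ε hε
    filter_upwards [(tendsto_rOut N).eventually (gt_mem_nhds hδ)] with n hn
    rw [← eLpNorm_restrict_eq_of_support_subset
      (s := Metric.closedBall (0 : Space N) (R + 1))]
    · refine eLpNorm_le_of_ae_bound (ae_of_all _ fun x => ?_)
      rw [Pi.sub_apply, ← dist_eq_norm, conv_mollifier_eq]
      refine ContDiffBump.dist_normed_convolution_le hh.aestronglyMeasurable fun y hy => ?_
      exact (hd (lt_trans (Metric.mem_ball.1 hy) hn)).le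
    · intro x hx
      by_contra hne
      exact hx (hsupp n x hne)
  rw [ENNReal.tendsto_nhds_zero]
  intro ε hε
  rcases eq_or_ne ε ∞ with rfl | hεt
  · simp
  have hpos : 0 < ε.toReal / (V.toReal + 1) := by
    have := ENNReal.toReal_pos hε.ne' hεt
    positivity
  filter_upwards [key _ hpos] with n hn
  refine hn.trans ?_
  rw [← ENNReal.ofReal_toReal hVt, ← ENNReal.ofReal_mul ENNReal.toReal_nonneg,
    ← ENNReal.ofReal_toReal hεt, ENNReal.toReal_ofReal ENNReal.toReal_nonneg,
    ENNReal.toReal_ofReal ENNReal.toReal_nonneg]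
  refine ENNReal.ofReal_le_ofReal ?_
  rw [mul_div_assoc', div_le_iff₀ (by positivity)]
  nlinarith [ENNReal.toReal_nonneg (a := V), ENNReal.toReal_nonneg (a := ε)]

/-- Mollifications of an `L²` function converge to it in `L²`: by density of `C_c` and since
mollification is a contraction. -/
theorem lpConv_conv (hh : MemLp h 2 volume) :
    LpConv 2 volume (fun n => conv (mollifier N n) h) h := by
  refine ⟨fun n => memLp_conv n hh, hh, ?_⟩
  rw [ENNReal.tendsto_nhds_zero]
  intro ε hε
  obtain ⟨k, hkc, hk, hkcont, hkL⟩ := hh.exists_hasCompactSupport_eLpNorm_sub_le (by simp)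
    (ENNReal.div_pos hε.ne' (by simp : (3 : ℝ≥0∞) ≠ ∞)).ne'
  filter_upwards [ENNReal.tendsto_nhds_zero.1 (tendsto_conv_of_continuous hkcont hkc) (ε / 3)
    (ENNReal.div_pos hε.ne' (by simp))] with n hn
  have hmc := (isSmooth_mollifier N n).continuous
  have hms := hasCompactSupport_mollifier N n
  have e : conv (mollifier N n) h - h
      = (conv (mollifier N n) (h - k) + (conv (mollifier N n) k - k)) + -(h - k) := by
    rw [conv_sub hmc hms (hh.locallyIntegrable (by norm_num))
      (hkL.locallyIntegrable (by norm_num))]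
    abel
  have m1 := memLp_conv n (hh.sub hkL)
  have m2 := (memLp_conv n hkL).sub hkL
  have m3 := (hh.sub hkL).neg
  rw [e]
  calc _ ≤ (eLpNorm (conv (mollifier N n) (h - k)) 2 volume
        + eLpNorm (conv (mollifier N n) k - k) 2 volume) + eLpNorm (-(h - k)) 2 volume :=
        (eLpNorm_add_le (m1.add m2).1 m3.1 (by norm_num)).trans
          (add_le_add_left (eLpNorm_add_le m1.1 m2.1 (by norm_num)) _)
    _ ≤ (ε / 3 + ε / 3) + ε / 3 := by
        refine add_le_add (add_le_add ((eLpNorm_conv_le n (hh.sub hkL).1).trans hk) hn) ?_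
        rwa [eLpNorm_neg]
    _ = ε := ENNReal.add_thirds ε

/-- The Lebesgue measure on the closed ball of radius `R`. -/
def ballMeasure (N : ℕ) (R : ℝ) : Measure (Space N) :=
  volume.restrict (Metric.closedBall 0 R)

theorem LpConv.restrict {p : ℝ≥0∞} {a : ℕ → Space N → ℂ} {a' : Space N → ℂ}
    (h : LpConv p volume a a') (R : ℝ) : LpConv p (ballMeasure N R) a a' :=
  ⟨fun n => (h.memLp n).restrict _, h.memLp_lim.restrict _,
    tendsto_of_tendsto_of_tendsto_of_le_of_le tendsto_const_nhds h.tendsto (fun _ => zero_le)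
      fun _ => eLpNorm_mono_measure _ Measure.restrict_le_self⟩

/-- Mollifications of a locally `L²` function converge in `L²` of any ball. -/
theorem lpConv_conv_ball (R : ℝ) (hh : MemLp h 2 (ballMeasure N (R + 1))) :
    LpConv 2 (ballMeasure N R) (fun n => conv (mollifier N n) h) h := by
  set s := Metric.closedBall (0 : Space N) (R + 1) with hs
  have hms : MeasurableSet s := Metric.isClosed_closedBall.measurableSet
  have h1 : MemLp (s.indicator h) 2 volume := (memLp_indicator_iff_restrict hms).2 hh
  have hae : ∀ (f f' : Space N → ℂ), (∀ x ∈ Metric.closedBall (0 : Space N) R, f x = f' x) →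
      f =ᵐ[ballMeasure N R] f' := fun f f' hf =>
    (ae_restrict_iff' Metric.isClosed_closedBall.measurableSet).2 (ae_of_all _ hf)
  refine ((lpConv_conv h1).restrict R).congr (fun n => hae _ _ fun x hx => ?_)
    (hae _ _ fun x hx => ?_)
  · refine integral_congr_ae (ae_of_all _ fun y => ?_)
    by_cases hy : y ∈ s
    · simp [hy]
    · have : 1 / ((n : ℝ) + 1) ≤ ‖x - y‖ := by
        have h2 : 1 / ((n : ℝ) + 1) ≤ 1 := by
          rw [div_le_one (by positivity)]
          linarith [n.cast_nonneg (α := ℝ)]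
        have h3 := norm_sub_norm_le y x
        rw [norm_sub_rev] at h3
        rw [hs, mem_closedBall_zero_iff, not_le] at hy
        rw [mem_closedBall_zero_iff] at hx
        linarith
      simp [mollifier_eq_zero this]
  · have : x ∈ s := Metric.closedBall_subset_closedBall (by linarith) hx
    simp [this]

end Mollify

/-! ### Local `L⁶` bounds for `H¹` functions -/

section Sobolev

open Filter Topology
open scoped ENNReal NNReal

variable {N : ℕ}

theorem norm_fderiv_le_sum_pd (u : Space N → ℂ) (x : Space N) :
    ‖fderiv ℝ u x‖ ≤ ∑ j, ‖pd j u x‖ := by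
  refine ContinuousLinearMap.opNorm_le_bound _ (Finset.sum_nonneg fun _ _ => norm_nonneg _)
    fun v => ?_
  have hv : v = ∑ j, v j • EuclideanSpace.single j (1 : ℝ) := by
    simpa using ((EuclideanSpace.basisFun (Fin N) ℝ).sum_repr v).symm
  calc ‖fderiv ℝ u x v‖ = ‖∑ j, v j • pd j u x‖ := by
        conv_lhs => rw [hv, map_sum]
        simp only [map_smul, pd]
    _ ≤ ∑ j, ‖v j • pd j u x‖ := norm_sum_le _ _
    _ ≤ ∑ j, ‖pd j u x‖ * ‖v‖ := by
        refine Finset.sum_le_sum fun j _ => ?_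
        rw [norm_smul, mul_comm]
        exact mul_le_mul_of_nonneg_left (PiLp.norm_apply_le v j) (norm_nonneg _)
    _ = _ := by rw [Finset.sum_mul]

theorem eLpNorm_fderiv_le_sum_pd {u : Space N → ℂ} (hu : IsSmooth u) {p : ℝ≥0∞} (hp : 1 ≤ p) :
    eLpNorm (fderiv ℝ u) p volume ≤ ∑ j, eLpNorm (pd j u) p volume := by
  calc eLpNorm (fderiv ℝ u) p volume
      ≤ eLpNorm (∑ j, fun x => ‖pd j u x‖) p volume := by
        refine eLpNorm_mono_real fun x => ?_
        simpa using norm_fderiv_le_sum_pd u x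
    _ ≤ ∑ j, eLpNorm (fun x => ‖pd j u x‖) p volume :=
        eLpNorm_sum_le (fun j _ => (hu.pd j).continuous.norm.aestronglyMeasurable) hp
    _ = _ := Finset.sum_congr rfl fun j _ => eLpNorm_norm _

theorem volume_closedBall_rpow_ne_top (R : ℝ) {a : ℝ} (ha : 0 ≤ a) :
    volume (Metric.closedBall (0 : Space N) R) ^ a ≠ ∞ :=
  ENNReal.rpow_ne_top_of_nonneg ha measure_closedBall_lt_top.ne

/-- Comparison of Lebesgue norms for functions supported in a ball. -/
theorem exists_eLpNorm_le_of_support_subset (N : ℕ) (R : ℝ) {p q : ℝ≥0∞} (hp : p ≠ 0)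
    (hpq : p ≤ q) : ∃ C : ℝ≥0∞, C ≠ ∞ ∧ ∀ u : Space N → ℂ, AEStronglyMeasurable u →
      Function.support u ⊆ Metric.closedBall 0 R →
        eLpNorm u p volume ≤ C * eLpNorm u q volume := by
  refine ⟨_, volume_closedBall_rpow_ne_top (N := N) R (a := 1 / p.toReal - 1 / q.toReal) ?_,
    fun u hu hs => ?_⟩
  · rcases eq_or_ne q ∞ with rfl | hq
    · simp
    · have h1 : 0 < p.toReal := ENNReal.toReal_pos hp (ne_top_of_le_ne_top hq hpq)
      exact sub_nonneg.2 (one_div_le_one_div_of_le h1 (ENNReal.toReal_mono hq hpq))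
  · have := eLpNorm_le_eLpNorm_mul_rpow_measure_univ hpq
      (hu.restrict (s := Metric.closedBall (0 : Space N) R))
    rw [eLpNorm_restrict_eq_of_support_subset hs, eLpNorm_restrict_eq_of_support_subset hs,
      Measure.restrict_apply_univ, mul_comm] at this
    exact this

theorem support_pd_subset {u : Space N → ℂ} {R : ℝ}
    (hs : Function.support u ⊆ Metric.closedBall 0 R) (j : Fin N) :
    Function.support (pd j u) ⊆ Metric.closedBall 0 R := by
  intro x hx
  have h1 : x ∈ Function.support (fderiv ℝ u) := by
    intro h0
    exact hx (by simp [pd, h0])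
  exact closure_minimal hs Metric.isClosed_closedBall (support_fderiv_subset ℝ h1)

/-- In dimension one a compactly supported function is bounded by the `L¹` norm of its
derivative. -/
theorem enorm_le_lintegral_pd {u : Space 1 → ℂ} (hu : IsSmooth u) (hc : HasCompactSupport u)
    (x : Space 1) : ‖u x‖ₑ ≤ ∫⁻ y, ‖pd 0 u y‖ₑ := by
  let e : ℝ ≃ₗᵢ[ℝ] Space 1 := (OrthonormalBasis.singleton (Fin 1) ℝ).repr
  have he1 : e 1 = EuclideanSpace.single 0 1 := by
    ext i
    fin_cases i
    change ((OrthonormalBasis.singleton (Fin 1) ℝ).repr 1).ofLp 0 = _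
    rw [OrthonormalBasis.repr_apply_apply]
    simp
  have hsm : ContDiff ℝ 1 (fun t => u (e t)) :=
    (hu.of_le (by simp)).comp e.toContinuousLinearEquiv.contDiff
  have hd : ∀ t, deriv (fun t => u (e t)) t = pd 0 u (e t) := by
    intro t
    have h1 : HasDerivAt (fun t => e t) (e 1) t := by
      simpa using (e.toContinuousLinearEquiv.hasFDerivAt (x := t)).hasDerivAt
    refine ((hu.differentiable (e t)).hasFDerivAt.comp_hasDerivAt t h1).deriv.trans ?_
    rw [he1]
    rfl
  have h := HasCompactSupport.enorm_le_lintegral_Ici_deriv hsm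
    (hc.comp_homeomorph e.toHomeomorph) (e.symm x)
  simp only [hd, LinearIsometryEquiv.apply_symm_apply] at h
  refine h.trans ((setLIntegral_le_lintegral _ _).trans (le_of_eq ?_))
  exact e.measurePreserving.lintegral_comp (hu.pd 0).continuous.measurable.enorm

/-- In dimension at most three, `‖u‖₆ ≤ C_R ‖∇u‖₂` for `u` supported in the ball of radius `R`.
The exponent is critical only for `N = 3`; for `N = 2` the Sobolev inequality is used with the
exponent `3 / 2`, and for `N = 1` the function is bounded by the `L¹` norm of its derivative. -/
theorem exists_sobolev_six (hN1 : 1 ≤ N) (hN3 : N ≤ 3) (R : ℝ) :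
    ∃ C : ℝ≥0∞, C ≠ ∞ ∧ ∀ u : Space N → ℂ, IsSmooth u →
      Function.support u ⊆ Metric.closedBall 0 R →
        eLpNorm u 6 volume ≤ C * ∑ j, eLpNorm (pd j u) 2 volume := by
  have hcs : ∀ u : Space N → ℂ, Function.support u ⊆ Metric.closedBall 0 R →
      HasCompactSupport u := fun u hs =>
    HasCompactSupport.of_support_subset_isCompact (isCompact_closedBall _ _) hs
  rcases Nat.lt_or_ge N 2 with h2 | h2
  · obtain rfl : N = 1 := by omega
    obtain ⟨C₁, hC₁, h₁⟩ := exists_eLpNorm_le_of_support_subset 1 R (p := 6) (q := ∞) (by simp)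
      le_top
    obtain ⟨C₂, hC₂, h₂⟩ := exists_eLpNorm_le_of_support_subset 1 R (p := 1) (q := 2) (by simp)
      (by norm_num)
    refine ⟨C₁ * C₂, ENNReal.mul_ne_top hC₁ hC₂, fun u hu hs => ?_⟩
    have h3 : eLpNorm u ∞ volume ≤ eLpNorm (pd 0 u) 1 volume := by
      rw [eLpNorm_exponent_top, eLpNorm_one_eq_lintegral_enorm]
      exact essSup_le_of_ae_le _ (ae_of_all _ fun x => enorm_le_lintegral_pd hu (hcs u hs) x)
    calc eLpNorm u 6 volume ≤ C₁ * eLpNorm u ∞ volume :=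
          h₁ u hu.continuous.aestronglyMeasurable hs
      _ ≤ C₁ * (C₂ * eLpNorm (pd 0 u) 2 volume) := by
          gcongr
          exact h3.trans (h₂ _ (hu.pd 0).continuous.aestronglyMeasurable (support_pd_subset hs 0))
      _ = _ := by simp [mul_assoc]
  · obtain ⟨p, hp1, hp2, hpN, hp6⟩ : ∃ p : ℝ≥0, 1 ≤ p ∧ p ≤ 2 ∧
        (p : ℝ) < N ∧ (p : ℝ)⁻¹ - (N : ℝ)⁻¹ ≤ ((6 : ℝ≥0) : ℝ)⁻¹ := by
      rcases (by omega : N = 2 ∨ N = 3) with rfl | rfl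
      · refine ⟨3 / 2, ?_, ?_, ?_, ?_⟩
        · rw [← NNReal.coe_le_coe]; norm_num
        · rw [← NNReal.coe_le_coe]; norm_num
        · norm_num
        · norm_num
      · exact ⟨2, by norm_num, le_rfl, by norm_num, by norm_num⟩
    obtain ⟨C₂, hC₂, h₂⟩ := exists_eLpNorm_le_of_support_subset N R (p := (p : ℝ≥0∞)) (q := 2)
      (by
        have : (0 : ℝ≥0) < p := lt_of_lt_of_le one_pos hp1
        exact_mod_cast this.ne') (by exact_mod_cast hp2)
    refine ⟨eLpNormLESNormFDerivOfLeConst ℂ volume (Metric.closedBall (0 : Space N) R) p 6 * C₂,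
      ENNReal.mul_ne_top (by simp) hC₂, fun u hu hs => ?_⟩
    have h3 := eLpNorm_le_eLpNorm_fderiv_of_le (μ := volume) (hu.of_le (by simp)) hs hp1
      (q := 6) (by rw [finrank_euclideanSpace_fin]; exact_mod_cast hpN)
      (by rw [finrank_euclideanSpace_fin]; exact hp6) Metric.isBounded_closedBall
    refine h3.trans ?_
    rw [mul_assoc]
    gcongr
    refine (eLpNorm_fderiv_le_sum_pd hu (by exact_mod_cast hp1)).trans ?_
    rw [Finset.mul_sum]
    exact Finset.sum_le_sum fun j _ =>
      h₂ _ (hu.pd j).continuous.aestronglyMeasurable (support_pd_subset hs j)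

/-- `φ ∈ H¹` with weak gradient `g`. -/
structure HasWeakGrad (φ : Space N → ℂ) (g : Fin N → Space N → ℂ) : Prop where
  memLp : MemLp φ 2 volume
  memLp_grad : ∀ j, MemLp (g j) 2 volume
  weak : ∀ j, IsWeakPartialDeriv j φ (g j)

theorem MemH1.exists_hasWeakGrad {φ : Space N → ℂ} (h : MemH1 φ) : ∃ g, HasWeakGrad φ g := by
  choose g hg using h.2
  exact ⟨g, h.1, fun j => (hg j).1, fun j => (hg j).2⟩

theorem HasWeakGrad.locallyIntegrable {φ : Space N → ℂ} {g : Fin N → Space N → ℂ}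
    (h : HasWeakGrad φ g) : LocallyIntegrable φ :=
  h.memLp.locallyIntegrable (by norm_num)

theorem HasWeakGrad.isSmooth_conv {φ : Space N → ℂ} {g : Fin N → Space N → ℂ}
    (h : HasWeakGrad φ g) (n : ℕ) : IsSmooth (conv (mollifier N n) φ) :=
  NLSSystem.isSmooth_conv (isSmooth_mollifier N n) (hasCompactSupport_mollifier N n)
    h.locallyIntegrable

theorem HasWeakGrad.pd_conv {φ : Space N → ℂ} {g : Fin N → Space N → ℂ}
    (h : HasWeakGrad φ g) (n : ℕ) (j : Fin N) :
    pd j (conv (mollifier N n) φ) = conv (mollifier N n) (g j) :=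
  pd_conv_of_weak (isSmooth_mollifier N n) (hasCompactSupport_mollifier N n)
    h.locallyIntegrable (h.weak j)

/-- A smooth cutoff equal to `1` on the ball of radius `R`. -/
theorem exists_cutoff (N : ℕ) (R : ℝ) : ∃ (ζ : Space N → ℂ) (R' : ℝ), IsSmooth ζ ∧
    HasCompactSupport ζ ∧ Function.support ζ ⊆ Metric.closedBall 0 R' ∧
      ∀ x ∈ Metric.closedBall (0 : Space N) R, ζ x = 1 := by
  let b : ContDiffBump (0 : Space N) := ⟨|R| + 1, |R| + 2, by positivity, by linarith⟩
  refine ⟨fun x => (b x : ℝ), |R| + 2, Complex.ofRealCLM.contDiff.comp b.contDiff,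
    b.hasCompactSupport.comp_left (g := fun r : ℝ => (r : ℂ)) (by simp), ?_, fun x hx => ?_⟩
  · intro x hx
    have : x ∈ Function.support b := by simpa using hx
    rw [b.support_eq] at this
    exact Metric.ball_subset_closedBall this
  · have : b x = 1 := b.one_of_mem_closedBall
      (Metric.closedBall_subset_closedBall (by linarith [le_abs_self R]) hx)
    simp [this]

theorem memLp_top_of_continuous {m : Space N → ℂ} (hm : Continuous m) (hc : HasCompactSupport m)
    (μ : Measure (Space N)) : MemLp m ∞ μ := by
  obtain ⟨C, hC⟩ := hc.exists_bound_of_continuous hm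
  exact memLp_top_of_bound hm.aestronglyMeasurable C (ae_of_all _ hC)

/-- Mollifications of an `H¹` function converge in `L⁶` of every ball. The Sobolev inequality
bounds the differences `ζ (uₙ - uₘ)` in `L⁶`, and Fatou's lemma lets `m → ∞`. -/
theorem HasWeakGrad.lpConv_six (hN1 : 1 ≤ N) (hN3 : N ≤ 3) {φ : Space N → ℂ}
    {g : Fin N → Space N → ℂ} (h : HasWeakGrad φ g) (R : ℝ) :
    LpConv 6 (ballMeasure N R) (fun n => conv (mollifier N n) φ) φ := by
  obtain ⟨ζ, R', hζ, hζc, hζs, hζ1⟩ := exists_cutoff N R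
  obtain ⟨C, hC, hS⟩ := exists_sobolev_six hN1 hN3 R'
  set u : ℕ → Space N → ℂ := fun n => conv (mollifier N n) φ with hu_def
  have hu : ∀ n, IsSmooth (u n) := h.isSmooth_conv
  have h2 := lpConv_conv h.memLp
  have h2g := fun j => lpConv_conv (h.memLp_grad j)
  have hA : ∀ j, MemLp (pd j ζ) ∞ volume := fun j =>
    memLp_top_of_continuous (hζ.pd j).continuous (hasCompactSupport_pd hζc j) _
  have hB : MemLp ζ ∞ volume := memLp_top_of_continuous hζ.continuous hζc _
  -- the bound for `ζ (uₙ - φ)`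
  set B : ℕ → ℝ≥0∞ := fun n => ∑ j, (eLpNorm (pd j ζ) ∞ volume * eLpNorm (u n - φ) 2 volume
    + eLpNorm ζ ∞ volume * eLpNorm (conv (mollifier N n) (g j) - g j) 2 volume) with hB_def
  have hBlim : Tendsto B atTop (𝓝 0) := by
    have : Tendsto B atTop (𝓝 (∑ j : Fin N, (eLpNorm (pd j ζ) ∞ volume * 0
        + eLpNorm ζ ∞ volume * 0))) :=
      tendsto_finsetSum _ fun j _ =>
        (ENNReal.Tendsto.const_mul h2.tendsto (Or.inr (hA j).eLpNorm_ne_top)).add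
          (ENNReal.Tendsto.const_mul (h2g j).tendsto (Or.inr hB.eLpNorm_ne_top))
    simpa using this
  have hBtop : ∀ n, B n ≠ ∞ := fun n => ENNReal.sum_ne_top.2 fun j _ =>
    ENNReal.add_ne_top.2 ⟨ENNReal.mul_ne_top (hA j).eLpNorm_ne_top
      ((h2.memLp n).sub h.memLp).eLpNorm_ne_top, ENNReal.mul_ne_top hB.eLpNorm_ne_top
      (((h2g j).memLp n).sub (h.memLp_grad j)).eLpNorm_ne_top⟩
  have hpair : ∀ n m, eLpNorm (fun x => ζ x * (u n x - u m x)) 6 volume ≤ C * (B n + B m) := by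
    intro n m
    refine (hS _ (hζ.mul ((hu n).sub (hu m))) ?_).trans ?_
    · exact (Function.support_mul_subset_left _ _).trans hζs
    · gcongr
      rw [hB_def, ← Finset.sum_add_distrib]
      refine Finset.sum_le_sum fun j _ => ?_
      have e : pd j (fun x => ζ x * (u n x - u m x))
          = pd j ζ • ((u n - φ) - (u m - φ)) + ζ • ((conv (mollifier N n) (g j) - g j)
            - (conv (mollifier N m) (g j) - g j)) := by
        ext x
        rw [((hζ.hasPd j).mul (((hu n).hasPd j).sub ((hu m).hasPd j))).2 x,
          h.pd_conv n j, h.pd_conv m j]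
        simp [u]
      have m1 := ((h2.memLp n).sub h.memLp).sub ((h2.memLp m).sub h.memLp)
      have m2 := (((h2g j).memLp n).sub (h.memLp_grad j)).sub
        (((h2g j).memLp m).sub (h.memLp_grad j))
      have m3 : MemLp (pd j ζ • ((u n - φ) - (u m - φ))) 2 volume := m1.smul (hA j)
      have m4 : MemLp (ζ • ((conv (mollifier N n) (g j) - g j)
        - (conv (mollifier N m) (g j) - g j))) 2 volume := m2.smul hB
      rw [e]
      refine (eLpNorm_add_le m3.1 m4.1 (by norm_num)).trans ?_
      have i3 := (eLpNorm_smul_le_mul_eLpNorm (p := ∞) (q := 2) (r := 2) m1.1 (hA j).1).trans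
        (mul_le_mul_right (eLpNorm_sub_le ((h2.memLp n).sub h.memLp).1 ((h2.memLp m).sub h.memLp).1
          (by norm_num : (1 : ℝ≥0∞) ≤ 2)) _)
      have i4 := (eLpNorm_smul_le_mul_eLpNorm (p := ∞) (q := 2) (r := 2) m2.1 hB.1).trans
        (mul_le_mul_right (eLpNorm_sub_le (((h2g j).memLp n).sub (h.memLp_grad j)).1
          (((h2g j).memLp m).sub (h.memLp_grad j)).1 (by norm_num : (1 : ℝ≥0∞) ≤ 2)) _)
      refine (add_le_add i3 i4).trans (le_of_eq ?_)
      ring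
  obtain ⟨ns, hns, hae⟩ := (tendstoInMeasure_of_tendsto_eLpNorm (by simp)
    (fun n => (h2.memLp n).1) h.memLp.1 h2.tendsto).exists_seq_tendsto_ae
  have hlim : ∀ n, eLpNorm (fun x => ζ x * (u n x - φ x)) 6 volume ≤ C * B n := by
    intro n
    refine (Lp.eLpNorm_lim_le_liminf_eLpNorm (f := fun i x => ζ x * (u n x - u (ns i) x))
      (fun i => (hζ.mul ((hu n).sub (hu (ns i)))).continuous.aestronglyMeasurable) _ ?_).trans ?_
    · filter_upwards [hae] with x hx
      exact (tendsto_const_nhds.sub hx).const_mul _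
    · have hl : Tendsto (fun i => C * (B n + B (ns i))) atTop (𝓝 (C * (B n + 0))) :=
        ENNReal.Tendsto.const_mul (tendsto_const_nhds.add (hBlim.comp hns.tendsto_atTop))
          (Or.inr hC)
      rw [add_zero] at hl
      rw [← hl.liminf_eq]
      exact liminf_le_liminf (Eventually.of_forall fun i => hpair n (ns i))
  have hball : ∀ n, eLpNorm (u n - φ) 6 (ballMeasure N R) ≤ C * B n := by
    intro n
    refine le_trans (le_of_eq ?_) ((eLpNorm_mono_measure _
      (Measure.restrict_le_self (s := Metric.closedBall (0 : Space N) R))).trans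
      (hlim n))
    refine eLpNorm_congr_ae ((ae_restrict_iff' Metric.isClosed_closedBall.measurableSet).2
      (ae_of_all _ fun x hx => ?_))
    simp [hζ1 x hx]
  have hmu : ∀ n, MemLp (u n) 6 (ballMeasure N R) := by
    intro n
    have : IsFiniteMeasure (ballMeasure N R) :=
      ⟨by rw [ballMeasure, Measure.restrict_apply_univ]; exact measure_closedBall_lt_top⟩
    obtain ⟨M, hM⟩ := (isCompact_closedBall (0 : Space N) R).exists_bound_of_continuousOn
      (hu n).continuous.continuousOn
    exact MemLp.of_bound (hu n).continuous.aestronglyMeasurable M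
      ((ae_restrict_iff' Metric.isClosed_closedBall.measurableSet).2 (ae_of_all _ hM))
  have hd : ∀ n, MemLp (u n - φ) 6 (ballMeasure N R) := fun n =>
    ⟨((hu n).continuous.aestronglyMeasurable).sub (h.memLp.restrict _).1,
      (hball n).trans_lt (ENNReal.mul_lt_top hC.lt_top (hBtop n).lt_top)⟩
  refine ⟨hmu, ?_, ?_⟩
  · simpa using (hmu 0).sub (hd 0)
  · have hl : Tendsto (fun n => C * B n) atTop (𝓝 (C * 0)) :=
      ENNReal.Tendsto.const_mul hBlim (Or.inr hC)
    rw [mul_zero] at hl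
    exact tendsto_of_tendsto_of_tendsto_of_le_of_le tendsto_const_nhds hl (fun _ => zero_le) hball

end Sobolev

/-! ### The stationary equations of the profiles -/

section Stationary

open Filter Topology

variable {N : ℕ}

/-- `φ` solves `Δ φ - i a c · ∇ φ - a ω φ + F = 0` on `ℝ^N` in the sense of distributions. -/
def SolvesStationary (a ω : ℝ) (c : Space N) (φ F : Space N → ℂ) : Prop :=
  ∀ χ : Space N → ℂ, IsSmooth χ → HasCompactSupport χ →
    ∫ x, (φ x * (∑ j, pd j (pd j χ) x + Complex.I * a * ∑ j, (c j : ℂ) * pd j χ x - a * ω * χ x)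
      + F x * χ x) = 0

theorem fderiv_apply_eq_sum_pd (χ : Space N → ℂ) (x v : Space N) :
    fderiv ℝ χ x v = ∑ j, (v j : ℂ) * pd j χ x := by
  have hv : v = ∑ j, v j • EuclideanSpace.single j (1 : ℝ) := by
    simpa using ((EuclideanSpace.basisFun (Fin N) ℝ).sum_repr v).symm
  conv_lhs => rw [hv, map_sum]
  simp [pd]

theorem pd_const_mul_translate {χ : Space N → ℂ} (hχ : IsSmooth χ) (C : ℂ) (v : Space N)
    (j : Fin N) : pd j (fun x => C * χ (x - v)) = fun x => C * pd j χ (x - v) := by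
  ext x
  have h1 : HasFDerivAt (fun y : Space N => y - v) (ContinuousLinearMap.id ℝ (Space N)) x :=
    (hasFDerivAt_id x).sub_const v
  have h2 := ((hχ.differentiable (x - v)).hasFDerivAt.comp x h1).const_mul C
  have h3 : pd j (fun x => C * χ (x - v)) x = _ :=
    congrArg (· (EuclideanSpace.single j 1)) h2.fderiv
  rw [h3]
  simp [pd]

/-- The Galilean shear `(t, x) ↦ (t, x - t c)`. -/
def shear (c : Space N) : (ℝ × Space N) ≃ₜ (ℝ × Space N) where
  toFun p := (p.1, p.2 - p.1 • c)
  invFun p := (p.1, p.2 + p.1 • c)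
  left_inv p := by simp
  right_inv p := by simp
  continuous_toFun := by fun_prop
  continuous_invFun := by fun_prop

theorem shear_apply (c : Space N) (p : ℝ × Space N) : shear c p = (p.1, p.2 - p.1 • c) := rfl

theorem measurePreserving_shear (c : Space N) :
    MeasurePreserving (shear c) volume volume := by
  refine (MeasurePreserving.id (volume : Measure ℝ)).skew_product
    (g := fun t x => x - t • c) (μc := volume) (μd := volume) ?_ ?_
  · exact (measurable_snd.sub (measurable_fst.smul_const c))
  · exact ae_of_all _ fun t => (measurePreserving_sub_right volume (t • c)).map_eq

theorem integral_shear (c : Space N) (G : ℝ × Space N → ℂ) :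
    ∫ p, G (shear c p) = ∫ p, G p :=
  (measurePreserving_shear c).integral_comp (shear c).measurableEmbedding G

/-- Testing the evolution equation against `θ(t) e^{-iωt} χ(x - c t)` gives the equation of the
profile. -/
theorem solvesStationary_of_solvesSchrodinger {a ω : ℝ} {c : Space N} {φ F : Space N → ℂ}
    {F' : ℝ × Space N → ℂ} (hφ : LocallyIntegrable φ) (hF : LocallyIntegrable F)
    (hF' : ∀ p, F' p = Complex.exp (Complex.I * (ω : ℂ) * (p.1 : ℂ)) * F (p.2 - p.1 • c))
    (h : SolvesSchrodinger a (travelling ω c φ) F') : SolvesStationary a ω c φ F := by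
  intro χ hχ hχc
  let b : ContDiffBump (0 : ℝ) := ⟨1, 2, one_pos, one_lt_two⟩
  let θ : ℝ → ℂ := fun t => (b.normed volume t : ℝ)
  have hθ : ContDiff ℝ (⊤ : ℕ∞) θ := Complex.ofRealCLM.contDiff.comp b.contDiff_normed
  have hθc : HasCompactSupport θ :=
    b.hasCompactSupport_normed.comp_left (g := fun r : ℝ => (r : ℂ)) (by simp)
  have hθ1 : ∫ t, θ t = 1 := by
    rw [integral_complex_ofReal, b.integral_normed, Complex.ofReal_one]
  have hθd : ∀ t, HasDerivAt θ (deriv θ t) t := fun t =>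
    (hθ.differentiable (by simp) t).hasDerivAt
  have hθi : Integrable θ := hθ.continuous.integrable_of_hasCompactSupport hθc
  have hθi' : Integrable (deriv θ) :=
    (hθ.continuous_deriv (by simp)).integrable_of_hasCompactSupport hθc.deriv
  have hθ0 : ∫ t, deriv θ t = 0 := integral_eq_zero_of_hasDerivAt_of_integrable hθd hθi' hθi
  let E : ℝ → ℂ := fun t => Complex.exp (-(Complex.I * (ω : ℂ) * (t : ℂ)))
  have hE : ∀ t, HasDerivAt E (-(Complex.I * ω) * E t) t := by
    intro t
    have h1 : HasDerivAt (fun t : ℝ => -(Complex.I * (ω : ℂ) * (t : ℂ)))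
        (-(Complex.I * (ω : ℂ) * 1)) t :=
      ((Complex.ofRealCLM.hasDerivAt (x := t)).const_mul (Complex.I * (ω : ℂ))).neg
    exact h1.cexp.congr_deriv (by simp only [E]; ring)
  have hEE : ∀ t : ℝ, Complex.exp (Complex.I * (ω : ℂ) * (t : ℂ)) * E t = 1 := fun t => by
    rw [← Complex.exp_add, add_neg_cancel, Complex.exp_zero]
  let Φ : ℝ × Space N → ℂ := fun p => θ p.1 * E p.1 * χ (p.2 - p.1 • c)
  have hΦ : ContDiff ℝ (⊤ : ℕ∞) Φ := by
    have e1 : ContDiff ℝ (⊤ : ℕ∞) (fun p : ℝ × Space N => θ p.1) := hθ.comp contDiff_fst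
    have e2 : ContDiff ℝ (⊤ : ℕ∞) (fun p : ℝ × Space N => E p.1) :=
      (contDiff_const.mul (Complex.ofRealCLM.contDiff.comp contDiff_fst)).neg.cexp
    have e3 : ContDiff ℝ (⊤ : ℕ∞) (fun p : ℝ × Space N => χ (p.2 - p.1 • c)) :=
      hχ.comp (contDiff_snd.sub (contDiff_fst.smul contDiff_const))
    exact (e1.mul e2).mul e3
  have hΦc : HasCompactSupport Φ := by
    have h1 : HasCompactSupport (fun p : ℝ × Space N => θ p.1 * E p.1 * χ p.2) := by
      refine HasCompactSupport.of_support_subset_isCompact (hθc.isCompact.prod hχc.isCompact) ?_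
      intro p hp
      refine ⟨subset_tsupport _ fun h0 => hp ?_, subset_tsupport _ fun h0 => hp ?_⟩
      · simp [h0]
      · simp [h0]
    exact h1.comp_homeomorph (shear c)
  have hlap : ∀ p, spaceLaplacian Φ p
      = θ p.1 * E p.1 * ∑ j, pd j (pd j χ) (p.2 - p.1 • c) := by
    intro p
    have hs : IsSmooth (fun x => Φ (p.1, x)) := hΦ.comp (contDiff_const.prodMk contDiff_id)
    rw [spaceLaplacian, laplacian_eq_sum_pd hs, Finset.mul_sum]
    refine Finset.sum_congr rfl fun j _ => ?_
    simp only [Φ]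
    rw [pd_const_mul_translate hχ, pd_const_mul_translate (hχ.pd j)]
  have htime : ∀ p, timeDeriv Φ p
      = deriv θ p.1 * E p.1 * χ (p.2 - p.1 • c) - Complex.I * ω * (θ p.1 * E p.1)
          * χ (p.2 - p.1 • c)
        - θ p.1 * E p.1 * ∑ j, (c j : ℂ) * pd j χ (p.2 - p.1 • c) := by
    rintro ⟨t, x⟩
    have h1 : HasDerivAt (fun t : ℝ => x - t • c) (-((1 : ℝ) • c)) t :=
      ((hasDerivAt_id t).smul_const c).const_sub x
    have h2 := (hχ.differentiable (x - t • c)).hasFDerivAt.comp_hasDerivAt t h1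
    have h3 := ((hθd t).mul (hE t)).mul h2
    have h4 : timeDeriv Φ (t, x) = _ := h3.deriv
    rw [h4]
    simp only [one_smul, map_neg, fderiv_apply_eq_sum_pd, Function.comp_apply, Pi.mul_apply]
    ring
  have key := h.2.2 Φ hΦ hΦc
  -- in the moving frame the integrand is `θ' A + θ B`, where `∫ θ' = 0` and `∫ θ = 1`
  let A : Space N → ℂ := fun y => φ y * (-(Complex.I * a) * χ y)
  let B : Space N → ℂ := fun x => φ x * (∑ j, pd j (pd j χ) x
    + Complex.I * a * ∑ j, (c j : ℂ) * pd j χ x - a * ω * χ x) + F x * χ x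
  have hint : ∀ {f m : Space N → ℂ}, LocallyIntegrable f → IsSmooth m → HasCompactSupport m →
      Integrable (fun x => f x * m x) := by
    intro f m hf hm hmc
    have := hf.integrable_smul_left_of_hasCompactSupport hm.continuous hmc
    simpa [mul_comm] using this
  have hA : Integrable A := hint hφ (contDiff_const.mul hχ) hχc.mul_left
  have hB : Integrable B := by
    have hs : IsSmooth (fun x => ∑ j, pd j (pd j χ) x
        + Complex.I * a * ∑ j, (c j : ℂ) * pd j χ x - a * ω * χ x) :=
      ((ContDiff.sum fun j _ => (hχ.pd j).pd j).add (contDiff_const.mul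
        (ContDiff.sum fun j _ => contDiff_const.mul (hχ.pd j)))).sub (contDiff_const.mul hχ)
    have hsc : HasCompactSupport (fun x => ∑ j, pd j (pd j χ) x
        + Complex.I * a * ∑ j, (c j : ℂ) * pd j χ x - a * ω * χ x) := by
      refine HasCompactSupport.of_support_subset_isCompact hχc.isCompact fun x hx => ?_
      by_contra hx'
      refine hx ?_
      have z1 : ∀ {m : Space N → ℂ}, tsupport m ⊆ tsupport χ → ∀ j,
          tsupport (pd j m) ⊆ tsupport χ := fun hm j =>
        (tsupport_fderiv_apply_subset ℝ _).trans hm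
      have z0 : ∀ {m : Space N → ℂ}, tsupport m ⊆ tsupport χ → m x = 0 := fun hm =>
        image_eq_zero_of_notMem_tsupport fun hh => hx' (hm hh)
      simp only [z0 (z1 (z1 subset_rfl _) _), z0 (z1 subset_rfl _), z0 subset_rfl]
      simp
    exact (hint hφ hs hsc).add (hint hF hχ hχc)
  have hpt : ∀ p, travelling ω c φ p * (-(Complex.I * (a : ℂ) * timeDeriv Φ p)
      + spaceLaplacian Φ p) + F' p * Φ p
      = (fun q : ℝ × Space N => deriv θ q.1 * A q.2 + θ q.1 * B q.2) (shear c p) := by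
    rintro ⟨t, x⟩
    have e1 := hEE t
    rw [htime, hlap, hF']
    simp only [travelling, shear_apply, Φ, A, B]
    set e := Complex.exp (Complex.I * (ω : ℂ) * (t : ℂ))
    have hI := Complex.I_sq
    linear_combination (φ (x - t • c) * (-(Complex.I * a) * deriv θ t * χ (x - t • c)
      - θ t * (a * ω * χ (x - t • c)) + θ t * (Complex.I * a
      * ∑ j, (c j : ℂ) * pd j χ (x - t • c)) + θ t * ∑ j, pd j (pd j χ) (x - t • c))
      + θ t * (F (x - t • c) * χ (x - t • c))) * e1
      + (e * E t * φ (x - t • c) * a * ω * θ t * χ (x - t • c)) * hI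
  rw [integral_congr_ae (ae_of_all _ hpt), integral_shear c
    (fun q : ℝ × Space N => deriv θ q.1 * A q.2 + θ q.1 * B q.2), Measure.volume_eq_prod,
    integral_add (hθi'.mul_prod hA) (hθi.mul_prod hB),
    integral_prod_mul, integral_prod_mul, hθ0, hθ1] at key
  simpa [B] using key

/-- The nonlinearities are covariant under the phases `e^{iωt}`, `e^{3iωt}`. -/
theorem nonlin_travelling (ω : ℝ) (c : Space N) (φ ψ : Space N → ℂ) (p : ℝ × Space N) :
    nonlinU (travelling ω c φ p) (travelling (3 * ω) c ψ p)
        = Complex.exp (Complex.I * (ω : ℂ) * (p.1 : ℂ))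
          * nonlinU (φ (p.2 - p.1 • c)) (ψ (p.2 - p.1 • c)) ∧
      nonlinV (travelling ω c φ p) (travelling (3 * ω) c ψ p)
        = Complex.exp (Complex.I * ((3 * ω : ℝ) : ℂ) * (p.1 : ℂ))
          * nonlinV (φ (p.2 - p.1 • c)) (ψ (p.2 - p.1 • c)) := by
  have h3 : Complex.exp (Complex.I * ((3 * ω : ℝ) : ℂ) * (p.1 : ℂ))
      = Complex.exp (Complex.I * (ω : ℂ) * (p.1 : ℂ)) ^ 3 := by
    rw [← Complex.exp_nat_mul]
    congr 1
    push_cast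
    ring
  have hn : ‖Complex.exp (Complex.I * (ω : ℂ) * (p.1 : ℂ))‖ = 1 := by
    rw [show Complex.I * (ω : ℂ) * (p.1 : ℂ) = ((ω * p.1 : ℝ) : ℂ) * Complex.I by
      push_cast; ring, Complex.norm_exp_ofReal_mul_I]
  simp only [travelling, h3]
  set e := Complex.exp (Complex.I * (ω : ℂ) * (p.1 : ℂ))
  have hc : conj e * e = 1 := by
    rw [Complex.conj_mul', hn]
    simp
  constructor
  · simp only [nonlinU, norm_mul, norm_pow, hn, one_mul, one_pow, map_mul]
    linear_combination (1 / 3 * conj (φ (p.2 - p.1 • c)) ^ 2 * ψ (p.2 - p.1 • c) * e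
      * (conj e * e + 1)) * hc
  · simp only [nonlinV, norm_mul, norm_pow, hn, one_mul, one_pow]
    ring

end Stationary

/-! ### The virial identity for weak solutions -/

section WeakVirial

open Filter Topology
open scoped ENNReal

variable {N : ℕ}

instance holderTriple_six_six_three : ENNReal.HolderTriple 6 6 3 := by
  refine ⟨?_⟩
  rw [← ENNReal.toReal_eq_toReal_iff' (by simp) (by simp), ENNReal.toReal_add (by simp) (by simp)]
  norm_num

instance holderTriple_three_six_two : ENNReal.HolderTriple 3 6 2 := by
  refine ⟨?_⟩
  rw [← ENNReal.toReal_eq_toReal_iff' (by simp) (by simp), ENNReal.toReal_add (by simp) (by simp)]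
  norm_num

theorem nonlinU_eq (u v : ℂ) : nonlinU u v
    = (1 / 9 * (u * conj u) + 2 * (v * conj v)) * u + 1 / 3 * conj u ^ 2 * v := by
  rw [nonlinU, Complex.mul_conj', Complex.mul_conj']
  push_cast
  ring

theorem nonlinV_eq (u v : ℂ) : nonlinV u v
    = (9 * (v * conj v) + 2 * (u * conj u)) * v + 1 / 9 * u ^ 3 := by
  rw [nonlinV, Complex.mul_conj', Complex.mul_conj']
  push_cast
  ring

section LpConv

variable {μ : Measure (Space N)} {u v : ℕ → Space N → ℂ} {u' v' : Space N → ℂ}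

/-- Products of three factors map `L⁶` convergence to `L²` convergence. -/
theorem LpConv.triple {w : ℕ → Space N → ℂ} {w' : Space N → ℂ} (hu : LpConv 6 μ u u')
    (hv : LpConv 6 μ v v') (hw : LpConv 6 μ w w') :
    LpConv 2 μ (fun n x => u n x * v n x * w n x) (fun x => u' x * v' x * w' x) :=
  (hu.mul (r := 3) (by norm_num) hv).mul (by norm_num) hw

theorem LpConv.nonlinU (hu : LpConv 6 μ u u') (hv : LpConv 6 μ v v') :
    LpConv 2 μ (fun n x => nonlinU (u n x) (v n x)) (fun x => nonlinU (u' x) (v' x)) := by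
  have key := (((hu.triple hu.star hu).const_mul (1 / 9)).add (by norm_num)
    ((hv.triple hv.star hu).const_mul 2)).add (by norm_num)
    ((hu.star.triple hu.star hv).const_mul (1 / 3))
  refine key.congr (fun n => ae_of_all _ fun x => ?_) (ae_of_all _ fun x => ?_) <;>
  · beta_reduce
    rw [nonlinU_eq]
    ring

theorem LpConv.nonlinV (hu : LpConv 6 μ u u') (hv : LpConv 6 μ v v') :
    LpConv 2 μ (fun n x => nonlinV (u n x) (v n x)) (fun x => nonlinV (u' x) (v' x)) := by
  have key := (((hv.triple hv.star hv).const_mul 9).add (by norm_num)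
    ((hu.triple hu.star hv).const_mul 2)).add (by norm_num)
    ((hu.triple hu hu).const_mul (1 / 9))
  refine key.congr (fun n => ae_of_all _ fun x => ?_) (ae_of_all _ fun x => ?_) <;>
  · beta_reduce
    rw [nonlinV_eq]
    ring

variable {ξ : Space N → ℂ} {w uj uk wj wk : ℕ → Space N → ℂ} {w' uj' uk' wj' wk' : Space N → ℂ}

theorem LpConv.mul_two (hu : LpConv 2 μ u u') (hv : LpConv 2 μ v v') :
    LpConv 1 μ (fun n x => u n x * v n x) (fun x => u' x * v' x) :=
  hu.mul le_rfl hv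

theorem LpConv.kineticDensity (hξ : IsSmooth ξ) (hc : HasCompactSupport ξ) (j k : Fin N)
    (hu : LpConv 2 μ u u') (huj : LpConv 2 μ uj uj') (huk : LpConv 2 μ uk uk')
    (hw : LpConv 2 μ w w') (hwj : LpConv 2 μ wj wj') (hwk : LpConv 2 μ wk wk') :
    LpConv 1 μ (fun n => kineticDensity j k ξ (u n) (uj n) (uk n) (w n) (wj n) (wk n))
      (kineticDensity j k ξ u' uj' uk' w' wj' wk') := by
  have b : ∀ l, MemLp (pd l ξ) ∞ μ := fun l =>
    memLp_top_of_continuous (hξ.pd l).continuous (hasCompactSupport_pd hc l) _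
  have b' : MemLp (pd j (pd k ξ)) ∞ μ :=
    memLp_top_of_continuous ((hξ.pd k).pd j).continuous
      (hasCompactSupport_pd (hasCompactSupport_pd hc k) j) _
  exact ((((((huj.mul_two hwk).add le_rfl (hwj.mul_two huk)).bdd_mul le_rfl (b j)).const_mul
    (-4)).add le_rfl (((huj.mul_two hwj).bdd_mul le_rfl (b k)).const_mul 2)).sub le_rfl
    (((huj.mul_two hw).add le_rfl (hwj.mul_two hu)).bdd_mul le_rfl b'))

theorem LpConv.momentumDensity (hξ : IsSmooth ξ) (hc : HasCompactSupport ξ) (j k : Fin N)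
    (hu : LpConv 2 μ u u') (huj : LpConv 2 μ uj uj') (huk : LpConv 2 μ uk uk')
    (hw : LpConv 2 μ w w') (hwj : LpConv 2 μ wj wj') (hwk : LpConv 2 μ wk wk') :
    LpConv 1 μ (fun n => momentumDensity j k ξ (u n) (uj n) (uk n) (w n) (wj n) (wk n))
      (momentumDensity j k ξ u' uj' uk' w' wj' wk') := by
  have b : ∀ l, MemLp (pd l ξ) ∞ μ := fun l =>
    memLp_top_of_continuous (hξ.pd l).continuous (hasCompactSupport_pd hc l) _
  exact (((((hu.mul_two hwk).sub le_rfl (hw.mul_two huk)).bdd_mul le_rfl (b j)).const_mul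
    (-2)).add le_rfl
    (((hu.mul_two hwj).sub le_rfl (hw.mul_two huj)).bdd_mul le_rfl (b k))).const_mul Complex.I

/-- The virial multiplier of a function `u` whose weak derivative `∂ₖ u` is `uk`: it is `virial`
with the derivative as a separate argument. -/
def weakVirial (k : Fin N) (ξ u uk : Space N → ℂ) (x : Space N) : ℂ :=
  4 * (ξ x * uk x) + pd k ξ x * u x

theorem LpConv.weakVirial (hξ : IsSmooth ξ) (hc : HasCompactSupport ξ) (k : Fin N)
    (hu : LpConv 2 μ u u') (huk : LpConv 2 μ uk uk') :
    LpConv 2 μ (fun n => weakVirial k ξ (u n) (uk n)) (weakVirial k ξ u' uk') :=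
  ((huk.bdd_mul (by norm_num) (memLp_top_of_continuous hξ.continuous hc _)).const_mul 4).add
    (by norm_num) (hu.bdd_mul (by norm_num)
      (memLp_top_of_continuous (hξ.pd k).continuous (hasCompactSupport_pd hc k) _))

end LpConv

/-- The density whose integral is the result of testing the linear part
`a ω φ + i a c · ∇ φ - Δ φ` of the stationary equation against the virial multiplier of `ξ eₖ`
(twice its real part). Here `g` is the weak gradient of `φ`. -/
def virialDensity (a ω : ℝ) (c : Space N) (k : Fin N) (ξ φ : Space N → ℂ)
    (g : Fin N → Space N → ℂ) (x : Space N) : ℂ :=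
  a * ω * (-2 * (pd k ξ x * (φ x * conj (φ x))))
    + a * ∑ j, (c j : ℂ) * momentumDensity j k ξ φ (g j) (g k) (fun x => conj (φ x))
      (fun x => conj (g j x)) (fun x => conj (g k x)) x
    - ∑ j, kineticDensity j k ξ φ (g j) (g k) (fun x => conj (φ x))
      (fun x => conj (g j x)) (fun x => conj (g k x)) x

theorem LpConv.virialDensity {μ : Measure (Space N)} {ξ : Space N → ℂ} {u : ℕ → Space N → ℂ}
    {u' : Space N → ℂ} {g : ℕ → Fin N → Space N → ℂ} {g' : Fin N → Space N → ℂ} (a ω : ℝ)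
    (c : Space N) (hξ : IsSmooth ξ) (hc : HasCompactSupport ξ) (k : Fin N)
    (hu : LpConv 2 μ u u') (hg : ∀ j, LpConv 2 μ (fun n => g n j) (g' j)) :
    LpConv 1 μ (fun n => virialDensity a ω c k ξ (u n) (g n)) (virialDensity a ω c k ξ u' g') := by
  have b : MemLp (pd k ξ) ∞ μ :=
    memLp_top_of_continuous (hξ.pd k).continuous (hasCompactSupport_pd hc k) _
  exact (((((hu.mul_two hu.star).bdd_mul le_rfl b).const_mul (-2)).const_mul (a * ω)).add le_rfl
    ((LpConv.sum le_rfl _ fun j => (LpConv.momentumDensity hξ hc j k hu (hg j) (hg k) hu.star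
      (hg j).star (hg k).star).const_mul (c j : ℂ)).const_mul (a : ℂ))).sub le_rfl
    (LpConv.sum le_rfl _ fun j => LpConv.kineticDensity hξ hc j k hu (hg j) (hg k) hu.star
      (hg j).star (hg k).star)

/-- The mollified stationary equation holds pointwise. -/
theorem SolvesStationary.mollify {a ω : ℝ} {c : Space N} {φ F ρ : Space N → ℂ}
    (h : SolvesStationary a ω c φ F) (hφ : LocallyIntegrable φ) (hF : LocallyIntegrable F)
    (hρ : IsSmooth ρ) (hc : HasCompactSupport ρ) (x : Space N) :
    ∑ j, pd j (pd j (conv ρ φ)) x = a * ω * conv ρ φ x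
      + a * ∑ j, (c j : ℂ) * (Complex.I * pd j (conv ρ φ) x) - conv ρ F x := by
  have hp : ∀ j, pd j (conv ρ φ) = conv (pd j ρ) φ := fun j => funext (pd_conv hρ hc hφ j)
  have hpp : ∀ j, pd j (conv (pd j ρ) φ) = conv (pd j (pd j ρ)) φ := fun j =>
    funext (pd_conv (hρ.pd j) (hasCompactSupport_pd hc j) hφ j)
  have h1 := h _ (isSmooth_reflect hρ x) (hasCompactSupport_reflect hc x)
  have e1 : ∀ j, pd j (fun y => ρ (x - y)) = fun y => (-1 : ℂ) * pd j ρ (x - y) := fun j => by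
    ext y
    rw [pd_reflect hρ]
    ring
  have e2 : ∀ j y, pd j (fun y => (-1 : ℂ) * pd j ρ (x - y)) y = pd j (pd j ρ) (x - y) := by
    intro j y
    rw [(((isSmooth_reflect (hρ.pd j) x).hasPd j).const_mul (-1)).2 y]
    beta_reduce
    rw [pd_reflect (hρ.pd j)]
    ring
  simp only [e1, e2] at h1
  have i1 : ∀ j, Integrable (fun y => pd j (pd j ρ) (x - y) * φ y) := fun j =>
    integrable_conv ((hρ.pd j).pd j).continuous
      (hasCompactSupport_pd (hasCompactSupport_pd hc j) j) hφ x
  have i2 : ∀ j, Integrable (fun y => pd j ρ (x - y) * φ y) := fun j =>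
    integrable_conv (hρ.pd j).continuous (hasCompactSupport_pd hc j) hφ x
  have i3 := integrable_conv hρ.continuous hc hφ x
  have i4 := integrable_conv hρ.continuous hc hF x
  have e3 : ∀ y, φ y * (∑ j, pd j (pd j ρ) (x - y) + Complex.I * a *
        ∑ j, (c j : ℂ) * ((-1 : ℂ) * pd j ρ (x - y)) - a * ω * ρ (x - y)) + F y * ρ (x - y)
      = ((∑ j, pd j (pd j ρ) (x - y) * φ y
        + ∑ j, (-(Complex.I * a * c j)) * (pd j ρ (x - y) * φ y))
        + (-(a * ω : ℂ)) * (ρ (x - y) * φ y)) + ρ (x - y) * F y := by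
    intro y
    have s1 : ∑ j, pd j (pd j ρ) (x - y) * φ y = (∑ j, pd j (pd j ρ) (x - y)) * φ y := by
      rw [Finset.sum_mul]
    have s2 : ∑ j, (-(Complex.I * a * c j)) * (pd j ρ (x - y) * φ y)
        = Complex.I * a * (∑ j, (c j : ℂ) * ((-1 : ℂ) * pd j ρ (x - y))) * φ y := by
      rw [Finset.mul_sum, Finset.sum_mul]
      exact Finset.sum_congr rfl fun j _ => by ring
    rw [s1, s2]
    ring
  simp only [e3] at h1
  have j1 := integrable_finsetSum Finset.univ fun j _ => i1 j
  have j2 := integrable_finsetSum Finset.univ fun j _ =>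
    (i2 j).const_mul (-(Complex.I * a * c j))
  have r1 := integral_add ((j1.add j2).add (i3.const_mul (-(a * ω : ℂ)))) i4
  have r2 := integral_add (j1.add j2) (i3.const_mul (-(a * ω : ℂ)))
  have r3 := integral_add j1 j2
  simp only [Pi.add_apply] at r1 r2
  rw [r1, r2, r3, integral_finsetSum _ fun j _ => i1 j,
    integral_finsetSum _ fun j _ => (i2 j).const_mul _] at h1
  simp only [integral_const_mul] at h1
  have s3 : ∑ j, -(Complex.I * a * c j) * ∫ y, pd j ρ (x - y) * φ y
      = -(a * ∑ j, (c j : ℂ) * (Complex.I * ∫ y, pd j ρ (x - y) * φ y)) := by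
    rw [Finset.mul_sum, ← Finset.sum_neg_distrib]
    exact Finset.sum_congr rfl fun j _ => by ring
  rw [s3] at h1
  simp only [hp, hpp]
  simp only [conv]
  linear_combination h1

/-- The virial identity for a smooth solution `u` of
`Δ u = a ω u + i a c · ∇ u - f`. -/
theorem integral_virial {a ω : ℝ} {c : Space N} {ξ u f : Space N → ℂ} (hξ : IsSmooth ξ)
    (hc : HasCompactSupport ξ) (hu : IsSmooth u) (k : Fin N)
    (h : ∀ x, ∑ j, pd j (pd j u) x = a * ω * u x
      + a * ∑ j, (c j : ℂ) * (Complex.I * pd j u x) - f x) :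
    ∫ x, (f x * weakVirial k ξ (fun x => conj (u x)) (fun x => conj (pd k u x)) x
      + conj (f x) * weakVirial k ξ u (pd k u) x)
      = ∫ x, virialDensity a ω c k ξ u (fun j => pd j u) x := by
  set w : Space N → ℂ := fun x => conj (u x) with hw_def
  have hw : IsSmooth w := hu.conj
  have hpw : ∀ j, (fun x => conj (pd j u x)) = pd j w := fun j =>
    funext fun x => (pd_conj hu j x).symm
  have hppw : ∀ j x, conj (pd j (pd j u) x) = pd j (pd j w) x := fun j x => by
    rw [← pd_conj (hu.pd j), hpw]
  have hf : ∀ x, f x = a * ω * u x + a * ∑ j, (c j : ℂ) * (Complex.I * pd j u x)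
      - ∑ j, pd j (pd j u) x := fun x => by rw [h x]; ring
  have hf' : ∀ x, conj (f x) = a * ω * w x - a * ∑ j, (c j : ℂ) * (Complex.I * pd j w x)
      - ∑ j, pd j (pd j w) x := fun x => by
    rw [hf x]
    simp only [map_sub, map_add, map_mul, map_sum, Complex.conj_ofReal, Complex.conj_I, hppw,
      ← hpw]
    simp only [neg_mul, mul_neg, Finset.sum_neg_distrib]
    ring
  have hS : ∀ v, IsSmooth v → IsSmooth (virial k ξ v) := fun v hv => hξ.virial hv k
  have hSc : ∀ v, HasCompactSupport (virial k ξ v) := hasCompactSupport_virial hc k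
  have hi : ∀ {p q : Space N → ℂ}, IsSmooth p → HasCompactSupport q → IsSmooth q →
      Integrable (fun x => p x * q x) := fun hp hqc hq =>
    (hp.mul hq).continuous.integrable_of_hasCompactSupport hqc.mul_left
  have i1 : Integrable (fun x => u x * virial k ξ w x + w x * virial k ξ u x) :=
    (hi hu (hSc _) (hS _ hw)).add (hi hw (hSc _) (hS _ hu))
  have i2 : ∀ j, Integrable (fun x => Complex.I * pd j u x * virial k ξ w x
      - Complex.I * pd j w x * virial k ξ u x) := fun j =>
    (hi (contDiff_const.mul (hu.pd j)) (hSc _) (hS _ hw)).sub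
      (hi (contDiff_const.mul (hw.pd j)) (hSc _) (hS _ hu))
  have i3 : ∀ j, Integrable (fun x => pd j (pd j u) x * virial k ξ w x
      + pd j (pd j w) x * virial k ξ u x) := fun j =>
    (hi ((hu.pd j).pd j) (hSc _) (hS _ hw)).add (hi ((hw.pd j).pd j) (hSc _) (hS _ hu))
  have e1 : ∀ x, f x * weakVirial k ξ w (pd k w) x + conj (f x) * weakVirial k ξ u (pd k u) x
      = (a * ω : ℂ) * (u x * virial k ξ w x + w x * virial k ξ u x)
        + (a : ℂ) * ∑ j, (c j : ℂ) * (Complex.I * pd j u x * virial k ξ w x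
          - Complex.I * pd j w x * virial k ξ u x)
        - ∑ j, (pd j (pd j u) x * virial k ξ w x + pd j (pd j w) x * virial k ξ u x) := by
    intro x
    rw [hf' x, hf x]
    have s1 : ∑ j, (c j : ℂ) * (Complex.I * pd j u x * virial k ξ w x
          - Complex.I * pd j w x * virial k ξ u x)
        = (∑ j, (c j : ℂ) * (Complex.I * pd j u x)) * virial k ξ w x
          - (∑ j, (c j : ℂ) * (Complex.I * pd j w x)) * virial k ξ u x := by
      rw [Finset.sum_mul, Finset.sum_mul, ← Finset.sum_sub_distrib]
      exact Finset.sum_congr rfl fun j _ => by ring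
    rw [s1, Finset.sum_add_distrib, ← Finset.sum_mul, ← Finset.sum_mul]
    simp only [weakVirial, virial]
    ring
  have i4 := (integrable_finsetSum Finset.univ fun j _ => (i2 j).const_mul (c j : ℂ)).const_mul
    (a : ℂ)
  have i5 := integrable_finsetSum Finset.univ fun j _ => i3 j
  have k1 : ∀ j, Integrable (momentumDensity j k ξ u (pd j u) (pd k u) w (pd j w) (pd k w)) :=
    fun j => (isSmooth_momentumDensity hξ hu hw j k).continuous.integrable_of_hasCompactSupport
      (hasCompactSupport_momentumDensity hc ..)
  have k2 : ∀ j, Integrable (kineticDensity j k ξ u (pd j u) (pd k u) w (pd j w) (pd k w)) :=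
    fun j => (isSmooth_kineticDensity hξ hu hw j k).continuous.integrable_of_hasCompactSupport
      (hasCompactSupport_kineticDensity hc ..)
  have k3 : Integrable (fun x => -2 * (pd k ξ x * (u x * w x))) :=
    (contDiff_const.mul ((hξ.pd k).mul (hu.mul hw))).continuous.integrable_of_hasCompactSupport
      (hasCompactSupport_pd hc k).mul_right.mul_left
  have k4 := (integrable_finsetSum Finset.univ fun j _ => (k1 j).const_mul (c j : ℂ)).const_mul
    (a : ℂ)
  have k5 := integrable_finsetSum Finset.univ fun j _ => k2 j
  have r1 := integral_sub ((i1.const_mul (a * ω : ℂ)).add i4) i5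
  have r2 := integral_add (i1.const_mul (a * ω : ℂ)) i4
  have r3 := integral_sub ((k3.const_mul (a * ω : ℂ)).add k4) k5
  have r4 := integral_add (k3.const_mul (a * ω : ℂ)) k4
  simp only [Pi.add_apply, integral_const_mul] at r1 r2 r3 r4
  rw [integral_finsetSum _ fun j _ => (i2 j).const_mul _] at r2
  rw [integral_finsetSum _ fun j _ => i3 j] at r1
  rw [integral_finsetSum _ fun j _ => (k1 j).const_mul _] at r4
  rw [integral_finsetSum _ fun j _ => k2 j] at r3
  simp only [integral_const_mul, integral_kinetic hξ hc hu hw, integral_momentum hξ hc hu hw,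
    integral_mass hξ hc hu hw] at r1 r2 r3 r4
  simp only [hpw, virialDensity]
  simp only [e1]
  rw [r1, r2]
  change _ = ∫ x, ((a * ω : ℂ) * (-2 * (pd k ξ x * (u x * w x)))
    + (a : ℂ) * ∑ j, (c j : ℂ) * momentumDensity j k ξ u (pd j u) (pd k u) w (pd j w) (pd k w) x
    - ∑ j, kineticDensity j k ξ u (pd j u) (pd k u) w (pd j w) (pd k w) x)
  rw [r3, r4]

theorem exists_tsupport_subset_ball {ξ : Space N → ℂ} (hc : HasCompactSupport ξ) :
    ∃ R, tsupport ξ ⊆ Metric.closedBall 0 R :=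
  hc.isCompact.isBounded.subset_closedBall 0

theorem integral_ballMeasure {f : Space N → ℂ} {s : Set (Space N)} {R : ℝ}
    (hs : s ⊆ Metric.closedBall 0 R) (hf : ∀ x, x ∉ s → f x = 0) :
    ∫ x, f x ∂(ballMeasure N R) = ∫ x, f x :=
  setIntegral_eq_integral_of_forall_compl_eq_zero fun x hx => hf x fun h => hx (hs h)

theorem tsupport_pd_subset {ξ η : Space N → ℂ} (h : tsupport η ⊆ tsupport ξ) (j : Fin N) :
    tsupport (pd j η) ⊆ tsupport ξ :=
  (tsupport_fderiv_apply_subset ℝ _).trans h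

theorem weakVirial_eq_zero {ξ : Space N → ℂ} (k : Fin N) (u uk : Space N → ℂ) {x : Space N}
    (hx : x ∉ tsupport ξ) : weakVirial k ξ u uk x = 0 := by
  have h0 : ξ x = 0 := image_eq_zero_of_notMem_tsupport hx
  have h1 : pd k ξ x = 0 :=
    image_eq_zero_of_notMem_tsupport fun h => hx (tsupport_pd_subset subset_rfl k h)
  simp [weakVirial, h0, h1]

theorem virialDensity_eq_zero {ξ : Space N → ℂ} (a ω : ℝ) (c : Space N) (k : Fin N)
    (φ : Space N → ℂ) (g : Fin N → Space N → ℂ) {x : Space N} (hx : x ∉ tsupport ξ) :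
    virialDensity a ω c k ξ φ g x = 0 := by
  have h1 : ∀ j, pd j ξ x = 0 := fun j =>
    image_eq_zero_of_notMem_tsupport fun h => hx (tsupport_pd_subset subset_rfl j h)
  have h2 : ∀ j, pd j (pd k ξ) x = 0 := fun j =>
    image_eq_zero_of_notMem_tsupport fun h =>
      hx (tsupport_pd_subset (tsupport_pd_subset subset_rfl k) j h)
  simp [virialDensity, momentumDensity, kineticDensity, h1, h2]

/-- The virial identity for a weak solution: the limit of the identity for its mollifications. -/
theorem integral_virial_of_weak {a ω : ℝ} {c : Space N} {φ F ξ : Space N → ℂ}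
    {g : Fin N → Space N → ℂ} (hφ : HasWeakGrad φ g) (hF : ∀ R, MemLp F 2 (ballMeasure N R))
    (hFl : LocallyIntegrable F) (h : SolvesStationary a ω c φ F) (hξ : IsSmooth ξ)
    (hc : HasCompactSupport ξ) (k : Fin N) :
    ∫ x, (F x * weakVirial k ξ (fun x => conj (φ x)) (fun x => conj (g k x)) x
      + conj (F x) * weakVirial k ξ φ (g k) x) = ∫ x, virialDensity a ω c k ξ φ g x := by
  obtain ⟨R, hR⟩ := exists_tsupport_subset_ball hc
  have hu := (lpConv_conv hφ.memLp).restrict R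
  have hg := fun j => (lpConv_conv (hφ.memLp_grad j)).restrict R
  have hf := lpConv_conv_ball R (hF (R + 1))
  have l1 := (((hf.mul_two (LpConv.weakVirial hξ hc k hu.star (hg k).star)).add le_rfl
    (hf.star.mul_two (LpConv.weakVirial hξ hc k hu (hg k))))).tendsto_integral
  have l2 := (LpConv.virialDensity a ω c hξ hc k hu hg).tendsto_integral
  have e : ∀ n, ∫ x, (conv (mollifier N n) F x * weakVirial k ξ
        (fun x => conj (conv (mollifier N n) φ x)) (fun x => conj (conv (mollifier N n) (g k) x)) x
      + conj (conv (mollifier N n) F x) * weakVirial k ξ (conv (mollifier N n) φ)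
        (conv (mollifier N n) (g k)) x) ∂(ballMeasure N R)
      = ∫ x, virialDensity a ω c k ξ (conv (mollifier N n) φ)
        (fun j => conv (mollifier N n) (g j)) x ∂(ballMeasure N R) := by
    intro n
    rw [integral_ballMeasure hR fun x hx => by simp [weakVirial_eq_zero _ _ _ hx],
      integral_ballMeasure hR fun x hx => virialDensity_eq_zero _ _ _ _ _ _ hx]
    have key := integral_virial hξ hc (hφ.isSmooth_conv n) k (f := conv (mollifier N n) F)
      (h.mollify hφ.locallyIntegrable hFl (isSmooth_mollifier N n)
        (hasCompactSupport_mollifier N n))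
    simp only [hφ.pd_conv] at key
    exact key
  have := tendsto_nhds_unique (l1.congr e) l2
  rwa [integral_ballMeasure hR fun x hx => by simp [weakVirial_eq_zero _ _ _ hx],
    integral_ballMeasure hR fun x hx => virialDensity_eq_zero _ _ _ _ _ _ hx] at this

/-- The cubic terms do not contribute to the virial identity. -/
theorem integral_nonlin_eq_zero (hN1 : 1 ≤ N) (hN3 : N ≤ 3) {φ ψ ξ : Space N → ℂ}
    {g h : Fin N → Space N → ℂ} (hφ : HasWeakGrad φ g) (hψ : HasWeakGrad ψ h)
    (hξ : IsSmooth ξ) (hc : HasCompactSupport ξ) (k : Fin N) :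
    (∫ x, (nonlinU (φ x) (ψ x) * weakVirial k ξ (fun x => conj (φ x)) (fun x => conj (g k x)) x
      + conj (nonlinU (φ x) (ψ x)) * weakVirial k ξ φ (g k) x))
    + ∫ x, (nonlinV (φ x) (ψ x) * weakVirial k ξ (fun x => conj (ψ x)) (fun x => conj (h k x)) x
      + conj (nonlinV (φ x) (ψ x)) * weakVirial k ξ ψ (h k) x) = 0 := by
  obtain ⟨R, hR⟩ := exists_tsupport_subset_ball hc
  have hu := (lpConv_conv hφ.memLp).restrict R
  have hg := (lpConv_conv (hφ.memLp_grad k)).restrict R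
  have hv := (lpConv_conv hψ.memLp).restrict R
  have hh := (lpConv_conv (hψ.memLp_grad k)).restrict R
  have hu6 := hφ.lpConv_six hN1 hN3 R
  have hv6 := hψ.lpConv_six hN1 hN3 R
  have lU := ((LpConv.nonlinU hu6 hv6).mul_two
    (LpConv.weakVirial hξ hc k hu.star hg.star)).add le_rfl
    ((LpConv.nonlinU hu6 hv6).star.mul_two (LpConv.weakVirial hξ hc k hu hg))
  have lV := ((LpConv.nonlinV hu6 hv6).mul_two
    (LpConv.weakVirial hξ hc k hv.star hh.star)).add le_rfl
    ((LpConv.nonlinV hu6 hv6).star.mul_two (LpConv.weakVirial hξ hc k hv hh))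
  have l := (lU.add le_rfl lV).tendsto_integral
  have e : ∀ n, ∫ x, ((nonlinU (conv (mollifier N n) φ x) (conv (mollifier N n) ψ x)
        * weakVirial k ξ (fun x => conj (conv (mollifier N n) φ x))
          (fun x => conj (conv (mollifier N n) (g k) x)) x
      + conj (nonlinU (conv (mollifier N n) φ x) (conv (mollifier N n) ψ x))
        * weakVirial k ξ (conv (mollifier N n) φ) (conv (mollifier N n) (g k)) x)
      + (nonlinV (conv (mollifier N n) φ x) (conv (mollifier N n) ψ x)
        * weakVirial k ξ (fun x => conj (conv (mollifier N n) ψ x))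
          (fun x => conj (conv (mollifier N n) (h k) x)) x
      + conj (nonlinV (conv (mollifier N n) φ x) (conv (mollifier N n) ψ x))
        * weakVirial k ξ (conv (mollifier N n) ψ) (conv (mollifier N n) (h k)) x))
        ∂(ballMeasure N R) = 0 := by
    intro n
    rw [integral_ballMeasure hR fun x hx => by simp [weakVirial_eq_zero _ _ _ hx]]
    have su := hφ.isSmooth_conv n
    have sv := hψ.isSmooth_conv n
    have key := integral_cubic hξ hc su su.conj sv sv.conj k
    refine Eq.trans (integral_congr_ae (ae_of_all _ fun x => ?_)) key
    simp only [virial, weakVirial, pd_conj su, pd_conj sv, hφ.pd_conv, hψ.pd_conv, nonlinU_eq,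
      nonlinV_eq]
    simp only [map_add, map_mul, map_pow, map_div₀, map_one, map_ofNat, Complex.conj_conj]
    ring
  have := tendsto_nhds_unique (l.congr e) tendsto_const_nhds
  rw [integral_add (memLp_one_iff_integrable.1 lU.memLp_lim)
    (memLp_one_iff_integrable.1 lV.memLp_lim)] at this
  rwa [integral_ballMeasure hR fun x hx => by simp [weakVirial_eq_zero _ _ _ hx],
    integral_ballMeasure hR fun x hx => by simp [weakVirial_eq_zero _ _ _ hx]] at this

theorem locallyIntegrable_of_memLp_ball {F : Space N → ℂ}
    (hF : ∀ R, MemLp F 2 (ballMeasure N R)) : LocallyIntegrable F := by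
  refine fun x => ⟨Metric.closedBall 0 (‖x‖ + 1), ?_, ?_⟩
  · refine Filter.mem_of_superset (Metric.ball_mem_nhds x one_pos) fun y hy => ?_
    rw [mem_closedBall_zero_iff]
    have h1 := norm_sub_norm_le y x
    rw [Metric.mem_ball, dist_eq_norm] at hy
    linarith
  · have : IsFiniteMeasure (ballMeasure N (‖x‖ + 1)) :=
      ⟨by rw [ballMeasure, Measure.restrict_apply_univ]; exact measure_closedBall_lt_top⟩
    exact (hF (‖x‖ + 1)).integrable (by norm_num)

/-- The virial identity of a travelling solitary wave for the vector field `ξ eₖ`. -/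
theorem integral_virialDensity_eq_zero (hN1 : 1 ≤ N) (hN3 : N ≤ 3) {γ ω : ℝ} {c : Space N}
    {φ ψ ξ : Space N → ℂ} {g h : Fin N → Space N → ℂ} (hφ : HasWeakGrad φ g)
    (hψ : HasWeakGrad ψ h) (hs : IsSolution γ (travelling ω c φ) (travelling (3 * ω) c ψ))
    (hξ : IsSmooth ξ) (hc : HasCompactSupport ξ) (k : Fin N) :
    (∫ x, virialDensity 1 ω c k ξ φ g x) + ∫ x, virialDensity γ (3 * ω) c k ξ ψ h x = 0 := by
  have hU : ∀ R, MemLp (fun x => nonlinU (φ x) (ψ x)) 2 (ballMeasure N R) := fun R =>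
    (LpConv.nonlinU (hφ.lpConv_six hN1 hN3 R) (hψ.lpConv_six hN1 hN3 R)).memLp_lim
  have hV : ∀ R, MemLp (fun x => nonlinV (φ x) (ψ x)) 2 (ballMeasure N R) := fun R =>
    (LpConv.nonlinV (hφ.lpConv_six hN1 hN3 R) (hψ.lpConv_six hN1 hN3 R)).memLp_lim
  have hUl := locallyIntegrable_of_memLp_ball hU
  have hVl := locallyIntegrable_of_memLp_ball hV
  have s1 := solvesStationary_of_solvesSchrodinger hφ.locallyIntegrable hUl
    (fun p => (nonlin_travelling ω c φ ψ p).1) hs.1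
  have s2 := solvesStationary_of_solvesSchrodinger hψ.locallyIntegrable hVl
    (fun p => (nonlin_travelling ω c φ ψ p).2) hs.2
  rw [← integral_virial_of_weak hφ hU hUl s1 hξ hc k,
    ← integral_virial_of_weak hψ hV hVl s2 hξ hc k]
  exact integral_nonlin_eq_zero hN1 hN3 hφ hψ hξ hc k

end WeakVirial

/-! ### The Pohozaev identity -/

section Pohozaev

open Filter Topology
open scoped ENNReal

variable {N : ℕ}

/-- The vector field `x` cut off outside a neighbourhood of the unit ball, componentwise. -/
theorem exists_cutoff_coordinate (k : Fin N) : ∃ ξ : Space N → ℂ, IsSmooth ξ ∧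
    HasCompactSupport ξ ∧
      ∀ x ∈ Metric.ball (0 : Space N) 1, ∀ j, pd j ξ x = if j = k then 1 else 0 := by
  obtain ⟨ζ, R, hζ, hζc, -, hζ1⟩ := exists_cutoff N 1
  let L : Space N →L[ℝ] ℂ := Complex.ofRealCLM.comp (EuclideanSpace.proj k)
  refine ⟨fun x => ζ x * L x, hζ.mul L.contDiff, hζc.mul_right, fun x hx j => ?_⟩
  have h : (fun x => ζ x * L x) =ᶠ[𝓝 x] L := by
    filter_upwards [Metric.isOpen_ball.mem_nhds hx] with y hy
    rw [hζ1 y (Metric.ball_subset_closedBall hy), one_mul]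
  rw [pd, h.fderiv_eq, L.fderiv]
  by_cases hjk : j = k
  · simp [L, hjk]
  · simp [L, hjk, Ne.symm hjk]

theorem pd_dilate {f : Space N → ℂ} (hf : IsSmooth f) (C : ℂ) (r : ℝ) (j : Fin N) :
    pd j (fun x => C * f (r • x)) = fun x => C * r * pd j f (r • x) := by
  ext x
  have h1 : HasFDerivAt (fun y : Space N => r • y) (r • ContinuousLinearMap.id ℝ (Space N)) x :=
    (hasFDerivAt_id x).const_smul r
  have h2 := ((hf.differentiable (r • x)).hasFDerivAt.comp x h1).const_mul C
  have h3 : pd j (fun x => C * f (r • x)) x = _ :=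
    congrArg (· (EuclideanSpace.single j 1)) h2.fderiv
  rw [h3]
  simp [pd, mul_assoc]

/-- The dilation `R ξ(x / R)` with `R = n + 1`. -/
def dilate (n : ℕ) (ξ : Space N → ℂ) (x : Space N) : ℂ :=
  ((n : ℂ) + 1) * ξ (((n : ℝ) + 1)⁻¹ • x)

theorem isSmooth_dilate {ξ : Space N → ℂ} (hξ : IsSmooth ξ) (n : ℕ) : IsSmooth (dilate n ξ) :=
  contDiff_const.mul (hξ.comp (contDiff_const_smul _))

theorem hasCompactSupport_dilate {ξ : Space N → ℂ} (hc : HasCompactSupport ξ) (n : ℕ) :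
    HasCompactSupport (dilate n ξ) :=
  (hc.comp_smul (by positivity : ((n : ℝ) + 1)⁻¹ ≠ 0)).mul_left

theorem pd_dilate_eq {ξ : Space N → ℂ} (hξ : IsSmooth ξ) (n : ℕ) (j : Fin N) :
    pd j (dilate n ξ) = fun x => pd j ξ (((n : ℝ) + 1)⁻¹ • x) := by
  have h : ((n : ℂ) + 1) ≠ 0 := Nat.cast_add_one_ne_zero n
  have : pd j (dilate n ξ) = _ := pd_dilate hξ ((n : ℂ) + 1) ((n : ℝ) + 1)⁻¹ j
  rw [this]
  ext x
  push_cast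
  rw [mul_inv_cancel₀ h, one_mul]

theorem pd_pd_dilate_eq {ξ : Space N → ℂ} (hξ : IsSmooth ξ) (n : ℕ) (j k : Fin N) :
    pd j (pd k (dilate n ξ))
      = fun x => ((n : ℂ) + 1)⁻¹ * pd j (pd k ξ) (((n : ℝ) + 1)⁻¹ • x) := by
  have := pd_dilate (hξ.pd k) 1 ((n : ℝ) + 1)⁻¹ j
  simp only [one_mul] at this
  rw [pd_dilate_eq hξ, this]
  push_cast
  rfl

/-- Dominated convergence for bounded coefficients. -/
theorem LpConv.bounded_mul {m : ℕ → Space N → ℂ} {m' : Space N → ℂ} {f : Space N → ℂ} {C : ℝ}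
    (hm : ∀ n, Continuous (m n)) (hC : ∀ n x, ‖m n x‖ ≤ C)
    (hlim : ∀ x, Tendsto (fun n => m n x) atTop (𝓝 (m' x))) (hf : MemLp f 1 volume) :
    LpConv 1 volume (fun n x => m n x * f x) (fun x => m' x * f x) := by
  have h1 : ∀ n, AEStronglyMeasurable (fun x => m n x * f x) volume := fun n =>
    (hm n).aestronglyMeasurable.mul hf.1
  have hfi := memLp_one_iff_integrable.1 hf
  have hl : ∀ᵐ x, Tendsto (fun n => m n x * f x) atTop (𝓝 (m' x * f x)) :=
    ae_of_all _ fun x => (hlim x).mul_const _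
  have hb : ∀ n, ∀ᵐ x, ‖m n x * f x‖ ≤ C * ‖f x‖ := fun n => ae_of_all _ fun x => by
    rw [norm_mul]
    exact mul_le_mul_of_nonneg_right (hC n x) (norm_nonneg _)
  have hm' : AEStronglyMeasurable (fun x => m' x * f x) volume :=
    aestronglyMeasurable_of_tendsto_ae _ h1 hl
  refine ⟨fun n => memLp_one_iff_integrable.2 ((hfi.norm.const_mul C).mono' (h1 n) (hb n)),
    memLp_one_iff_integrable.2 ((hfi.norm.const_mul C).mono' hm' (ae_of_all _ fun x => ?_)), ?_⟩
  · rw [norm_mul]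
    exact mul_le_mul_of_nonneg_right
      (le_of_tendsto (hlim x).norm (Eventually.of_forall fun n => hC n x)) (norm_nonneg _)
  · have := tendsto_lintegral_norm_of_dominated_convergence h1
      (hfi.norm.const_mul C).hasFiniteIntegral hb hl
    simpa only [eLpNorm_one_eq_lintegral_enorm, ← ofReal_norm, Pi.sub_apply] using this

/-- The limit of `virialDensity` as the vector field `ξ eₖ` tends to `xₖ eₖ`. The factors
`1` and `0` are the limits of `∂ₖ ξ` and `∂ⱼ∂ₖ ξ`. -/
def limitDensity (a ω : ℝ) (c : Space N) (k : Fin N) (φ : Space N → ℂ)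
    (g : Fin N → Space N → ℂ) (x : Space N) : ℂ :=
  a * ω * (-2 * (1 * (φ x * conj (φ x))))
    + a * ∑ j, (c j : ℂ) * (Complex.I * (-2 * ((if j = k then 1 else 0)
        * (φ x * conj (g k x) - conj (φ x) * g k x))
      + 1 * (φ x * conj (g j x) - conj (φ x) * g j x)))
    - ∑ j, (-4 * ((if j = k then 1 else 0) * (g j x * conj (g k x) + conj (g j x) * g k x))
      + 2 * (1 * (g j x * conj (g j x))) - 0 * (g j x * conj (φ x) + conj (g j x) * φ x))

theorem lpConv_virialDensity_dilate {φ ξ : Space N → ℂ} {g : Fin N → Space N → ℂ}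
    (h : HasWeakGrad φ g) (a ω : ℝ) (c : Space N) (hξ : IsSmooth ξ) (hc : HasCompactSupport ξ)
    (k : Fin N)
    (hk : ∀ x ∈ Metric.ball (0 : Space N) 1, ∀ j, pd j ξ x = if j = k then 1 else 0) :
    LpConv 1 volume (fun n => virialDensity a ω c k (dilate n ξ) φ g)
      (limitDensity a ω c k φ g) := by
  have hr : Tendsto (fun n : ℕ => ((n : ℝ) + 1)⁻¹) atTop (𝓝 0) := by
    simpa using tendsto_one_div_add_atTop_nhds_zero_nat (𝕜 := ℝ)
  have h0 : ∀ x : Space N, Tendsto (fun n : ℕ => ((n : ℝ) + 1)⁻¹ • x) atTop (𝓝 0) := fun x => by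
    simpa using hr.smul_const x
  have b1 : ∀ j {f : Space N → ℂ}, MemLp f 1 volume →
      LpConv 1 volume (fun n x => pd j (dilate n ξ) x * f x)
        (fun x => (if j = k then 1 else 0) * f x) := by
    intro j f hf
    obtain ⟨C, hC⟩ := (hasCompactSupport_pd hc j).exists_bound_of_continuous (hξ.pd j).continuous
    refine LpConv.bounded_mul (m' := fun _ => if j = k then 1 else 0)
      (fun n => ((isSmooth_dilate hξ n).pd j).continuous) (C := C)
      (fun n x => by rw [pd_dilate_eq hξ]; exact hC _) (fun x => ?_) hf
    refine tendsto_const_nhds.congr' ?_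
    filter_upwards [(h0 x).eventually (Metric.ball_mem_nhds 0 one_pos)] with n hn
    rw [pd_dilate_eq hξ]
    exact (hk _ hn j).symm
  have b1' : ∀ {f : Space N → ℂ}, MemLp f 1 volume →
      LpConv 1 volume (fun n x => pd k (dilate n ξ) x * f x) (fun x => 1 * f x) := fun hf => by
    simpa using b1 k hf
  have b2 : ∀ j {f : Space N → ℂ}, MemLp f 1 volume →
      LpConv 1 volume (fun n x => pd j (pd k (dilate n ξ)) x * f x) (fun x => 0 * f x) := by
    intro j f hf
    have hcj := hasCompactSupport_pd (hasCompactSupport_pd hc k) j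
    obtain ⟨C, hC⟩ := hcj.exists_bound_of_continuous ((hξ.pd k).pd j).continuous
    have hn : ∀ n : ℕ, ‖((n : ℂ) + 1)⁻¹‖ = ((n : ℝ) + 1)⁻¹ := fun n => by
      rw [norm_inv]
      norm_cast
    have hle : ∀ (n : ℕ) (x : Space N), ‖pd j (pd k (dilate n ξ)) x‖ ≤ ((n : ℝ) + 1)⁻¹ * C := by
      intro n x
      rw [pd_pd_dilate_eq hξ, norm_mul, hn]
      exact mul_le_mul_of_nonneg_left (hC _) (by positivity)
    have hC0 : 0 ≤ C := (norm_nonneg _).trans (hC 0)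
    refine LpConv.bounded_mul (m' := fun _ => 0)
      (fun n => (((isSmooth_dilate hξ n).pd k).pd j).continuous) (C := C)
      (fun n x => (hle n x).trans ?_) (fun x => ?_) hf
    · refine mul_le_of_le_one_left hC0 (inv_le_one_of_one_le₀ ?_)
      linarith [n.cast_nonneg (α := ℝ)]
    · exact squeeze_zero_norm (fun n => hle n x) (by simpa using hr.mul_const C)
  have m : ∀ {f₁ f₂ : Space N → ℂ}, MemLp f₁ 2 volume → MemLp f₂ 2 volume →
      MemLp (fun x => f₁ x * f₂ x) 1 volume := fun h₁ h₂ => h₂.mul' h₁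
  have hφ := h.memLp
  have hφ' : MemLp (fun x => conj (φ x)) 2 volume := MemLp.star hφ
  have hg := h.memLp_grad
  have hg' : ∀ j, MemLp (fun x => conj (g j x)) 2 volume := fun j => MemLp.star (hg j)
  exact ((((b1' (m hφ hφ')).const_mul (-2)).const_mul (a * ω)).add le_rfl
    ((LpConv.sum le_rfl _ fun j => (((((b1 j ((m hφ (hg' k)).sub (m hφ' (hg k)))).const_mul
      (-2)).add le_rfl (b1' ((m hφ (hg' j)).sub (m hφ' (hg j))))).const_mul Complex.I).const_mul
      (c j : ℂ))).const_mul (a : ℂ))).sub le_rfl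
    (LpConv.sum le_rfl _ fun j => ((((b1 j ((m (hg j) (hg' k)).add (m (hg' j) (hg k)))).const_mul
      (-4)).add le_rfl ((b1' (m (hg j) (hg' j))).const_mul 2)).sub le_rfl
      (b2 j ((m (hg j) hφ').add (m (hg' j) hφ)))))

/-- The density of the Pohozaev identity, obtained with the multiplier `4 x · ∇ φ + N φ`;
here `g` is the weak gradient of `φ`. -/
def pohozaevDensity (a ω : ℝ) (c : Space N) (φ : Space N → ℂ) (g : Fin N → Space N → ℂ)
    (x : Space N) : ℝ :=
  (4 - N) * ∑ j, ‖g j x‖ ^ 2 - N * (a * ω) * ‖φ x‖ ^ 2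
    - (N - 2) * (a * (φ x * ∑ j, (c j : ℂ) * conj (g j x)).im)

/-- The factor `2` comes from pairing with the multiplier and with its conjugate. -/
theorem sum_limitDensity (a ω : ℝ) (c : Space N) (φ : Space N → ℂ) (g : Fin N → Space N → ℂ)
    (x : Space N) :
    ∑ k, limitDensity a ω c k φ g x = 2 * (pohozaevDensity a ω c φ g x : ℂ) := by
  have hI := Complex.I_sq
  have e1 : ∀ z : ℂ, z - conj z = 2 * Complex.I * (z.im : ℂ) := fun z => by
    rw [Complex.sub_conj]
    push_cast
    ring
  have e2 : ∀ j, φ x * conj (g j x) - conj (φ x) * g j x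
      = 2 * Complex.I * ((φ x * conj (g j x)).im : ℂ) := fun j => by
    rw [← e1]
    simp
  have e3 : (φ x * ∑ j, (c j : ℂ) * conj (g j x)).im
      = ∑ j, c j * (φ x * conj (g j x)).im := by
    rw [Finset.mul_sum, Complex.im_sum]
    refine Finset.sum_congr rfl fun j _ => ?_
    rw [mul_left_comm, Complex.im_ofReal_mul]
  have e4 : ∀ j, g j x * conj (g j x) = ((‖g j x‖ ^ 2 : ℝ) : ℂ) := fun j => by
    rw [Complex.mul_conj']
    push_cast
    rfl
  set M : Fin N → ℂ := fun j => ((φ x * conj (g j x)).im : ℂ) with hM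
  set G : Fin N → ℂ := fun j => ((‖g j x‖ ^ 2 : ℝ) : ℂ) with hG
  have s : ∀ k, limitDensity a ω c k φ g x = -2 * (a * ω) * ((‖φ x‖ ^ 2 : ℝ) : ℂ)
      + a * ∑ j, ((if j = k then 4 * (c j * M j) else 0) + -2 * (c j * M j))
      - ∑ j, ((if j = k then -8 * G j else 0) + 2 * G j) := by
    intro k
    rw [limitDensity, Complex.mul_conj']
    congr 1
    · congr 1
      · push_cast
        ring
      · congr 1
        refine Finset.sum_congr rfl fun j _ => ?_
        rw [e2, e2]
        split_ifs with hjk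
        · subst hjk
          linear_combination (-2 * (c j * M j)) * hI
        · linear_combination (2 * (c j * M j)) * hI
    · refine Finset.sum_congr rfl fun j _ => ?_
      rw [e4]
      split_ifs with hjk
      · subst hjk
        rw [mul_comm (conj (g j x)), e4]
        ring
      · ring
  simp only [s, Finset.sum_add_distrib, Finset.sum_sub_distrib, ← Finset.mul_sum,
    Finset.sum_ite_eq', Finset.sum_const, Finset.card_univ, Fintype.card_fin, nsmul_eq_mul]
  simp only [Finset.mem_univ, if_true, ← Finset.mul_sum]
  rw [pohozaevDensity, e3]
  push_cast
  simp only [hM, hG]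
  push_cast
  ring

/-- The Pohozaev identity of a travelling solitary wave. -/
theorem integral_pohozaev (hN1 : 1 ≤ N) (hN3 : N ≤ 3) {γ ω : ℝ} {c : Space N}
    {φ ψ : Space N → ℂ} {g h : Fin N → Space N → ℂ} (hφ : HasWeakGrad φ g)
    (hψ : HasWeakGrad ψ h) (hs : IsSolution γ (travelling ω c φ) (travelling (3 * ω) c ψ)) :
    Integrable (pohozaevDensity 1 ω c φ g) ∧ Integrable (pohozaevDensity γ (3 * ω) c ψ h) ∧
    (∫ x, pohozaevDensity 1 ω c φ g x) + ∫ x, pohozaevDensity γ (3 * ω) c ψ h x = 0 := by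
  choose ξ hξ hc hk using fun k : Fin N => exists_cutoff_coordinate k
  have l1 := fun k => lpConv_virialDensity_dilate hφ 1 ω c (hξ k) (hc k) k (hk k)
  have l2 := fun k => lpConv_virialDensity_dilate hψ γ (3 * ω) c (hξ k) (hc k) k (hk k)
  have i1 := fun k => memLp_one_iff_integrable.1 (l1 k).memLp_lim
  have i2 := fun k => memLp_one_iff_integrable.1 (l2 k).memLp_lim
  have h0 : ∀ k, (∫ x, limitDensity 1 ω c k φ g x) + ∫ x, limitDensity γ (3 * ω) c k ψ h x = 0 :=
    fun k => tendsto_nhds_unique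
      (((l1 k).tendsto_integral.add (l2 k).tendsto_integral).congr fun n =>
        integral_virialDensity_eq_zero hN1 hN3 hφ hψ hs (isSmooth_dilate (hξ k) n)
          (hasCompactSupport_dilate (hc k) n) k) tendsto_const_nhds
  have h1 := Finset.sum_eq_zero fun k (_ : k ∈ Finset.univ) => h0 k
  rw [Finset.sum_add_distrib, ← integral_finsetSum _ fun k _ => i1 k,
    ← integral_finsetSum _ fun k _ => i2 k] at h1
  have j1 := integrable_finsetSum Finset.univ fun k _ => i1 k
  have j2 := integrable_finsetSum Finset.univ fun k _ => i2 k
  simp only [sum_limitDensity] at h1 j1 j2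
  have hre : ∀ f : Space N → ℝ, Integrable (fun x => 2 * (f x : ℂ)) → Integrable f := by
    intro f hf
    have := (hf.const_mul (1 / 2)).re
    refine this.congr (ae_of_all _ fun x => ?_)
    simp
  refine ⟨hre _ j1, hre _ j2, ?_⟩
  rw [integral_const_mul, integral_const_mul, integral_complex_ofReal, integral_complex_ofReal,
    ← mul_add] at h1
  have := (mul_eq_zero.1 h1).resolve_left two_ne_zero
  exact_mod_cast this

end Pohozaev

/-! ### Coercivity and nonexistence -/

section Nonexistence

variable {N : ℕ}

/-- An `H¹` function on `ℝ^N`, `N ≥ 1`, whose weak gradient vanishes is zero. -/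
theorem HasWeakGrad.eq_zero (hN1 : 1 ≤ N) {φ : Space N → ℂ} {g : Fin N → Space N → ℂ}
    (h : HasWeakGrad φ g) (hg : ∀ j, g j =ᵐ[volume] 0) : φ =ᵐ[volume] 0 := by
  have : Nonempty (Fin N) := ⟨⟨0, hN1⟩⟩
  have hz : ∀ n, conv (mollifier N n) φ = 0 := by
    intro n
    have hs := h.isSmooth_conv n
    have hpd : ∀ j x, pd j (conv (mollifier N n) φ) x = 0 := by
      intro j x
      rw [h.pd_conv, conv_congr_ae _ (hg j)]
      simp [conv]
    have hf : ∀ x, fderiv ℝ (conv (mollifier N n) φ) x = 0 := by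
      intro x
      ext v
      simp [fderiv_apply_eq_sum_pd, hpd]
    have hconst : conv (mollifier N n) φ = fun _ => conv (mollifier N n) φ 0 :=
      funext fun x => is_const_of_fderiv_eq_zero hs.differentiable hf x 0
    have hm := memLp_conv n h.memLp
    rw [hconst, memLp_const_iff (by simp) (by simp)] at hm
    rw [hconst, hm.resolve_right (by simp)]
    rfl
  have hl := (lpConv_conv h.memLp).tendsto
  simp only [hz, zero_sub, eLpNorm_neg] at hl
  exact (eLpNorm_eq_zero_iff h.memLp.1 (by simp)).1 (tendsto_nhds_unique tendsto_const_nhds hl)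

theorem abs_im_le (c : Space N) (z : ℂ) (w : Fin N → ℂ) :
    |(z * ∑ j, (c j : ℂ) * conj (w j)).im| ≤ ‖c‖ * (‖z‖ * √(∑ j, ‖w j‖ ^ 2)) := by
  have h1 : ‖∑ j, (c j : ℂ) * conj (w j)‖ ≤ ‖c‖ * √(∑ j, ‖w j‖ ^ 2) := by
    refine (norm_sum_le _ _).trans ?_
    simp only [norm_mul, Complex.norm_real, RCLike.norm_conj]
    rw [EuclideanSpace.norm_eq]
    exact Real.sum_mul_le_sqrt_mul_sqrt _ _ _
  calc _ ≤ ‖z * ∑ j, (c j : ℂ) * conj (w j)‖ := Complex.abs_im_le_norm _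
    _ ≤ ‖z‖ * (‖c‖ * √(∑ j, ‖w j‖ ^ 2)) := by
        rw [norm_mul]
        exact mul_le_mul_of_nonneg_left h1 (norm_nonneg _)
    _ = _ := by ring

/-- In dimensions one and three the momentum term is absorbed by Young's inequality
`a |c| |φ| |g| ≤ a |c| (m |φ|² / 2 + |g|² / (2 m))`. The weight is the ratio `m` of the frequency
`m ω` of the component to `ω`, so that the first term is compensated by `-N a m ω |φ|²`. -/
theorem le_pohozaevDensity (hN : N = 1 ∨ N = 3) {a m ω : ℝ} (ha : 0 < a) (hm : 0 < m)
    {c : Space N} (hω : ω ≤ -(‖c‖ / (2 * (N : ℝ)))) (φ : Space N → ℂ)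
    (g : Fin N → Space N → ℂ) (x : Space N) :
    (4 - N - a * ‖c‖ / (2 * m)) * ∑ j, ‖g j x‖ ^ 2 ≤ pohozaevDensity a (m * ω) c φ g x := by
  have h1 := abs_im_le c (φ x) (fun j => g j x)
  set I := (φ x * ∑ j, (c j : ℂ) * conj (g j x)).im with hI
  set S := ∑ j, ‖g j x‖ ^ 2 with hS
  have hS0 : 0 ≤ S := Finset.sum_nonneg fun _ _ => sq_nonneg _
  have hsq : √S ^ 2 = S := Real.sq_sqrt hS0
  have hNω : N * ω ≤ -(‖c‖ / 2) := by
    rcases hN with rfl | rfl <;> norm_num at hω ⊢ <;> linarith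
  have hI2 : (N - 2) * (a * I) ≤ a * |I| := by
    rcases hN with rfl | rfl
    · have := neg_abs_le I
      norm_num
      nlinarith
    · have := le_abs_self I
      norm_num
      nlinarith
  have hy : ‖φ x‖ * √S ≤ m / 2 * ‖φ x‖ ^ 2 + S / (2 * m) := by
    have h2 : 0 ≤ (m * ‖φ x‖ - √S) ^ 2 / (2 * m) := by positivity
    have h3 : (m * ‖φ x‖ - √S) ^ 2 / (2 * m)
        = m / 2 * ‖φ x‖ ^ 2 - ‖φ x‖ * √S + S / (2 * m) := by
      rw [sub_sq, hsq]
      field_simp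
    linarith
  have h4 : a * |I| ≤ a * (‖c‖ * (m / 2 * ‖φ x‖ ^ 2 + S / (2 * m))) :=
    mul_le_mul_of_nonneg_left (h1.trans (mul_le_mul_of_nonneg_left hy (norm_nonneg _))) ha.le
  have h5 : N * (a * (m * ω)) * ‖φ x‖ ^ 2 ≤ -(a * m * (‖c‖ / 2)) * ‖φ x‖ ^ 2 := by
    refine mul_le_mul_of_nonneg_right ?_ (sq_nonneg _)
    have := mul_le_mul_of_nonneg_left hNω (mul_pos ha hm).le
    linarith
  have h6 : a * (‖c‖ * (m / 2 * ‖φ x‖ ^ 2 + S / (2 * m)))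
      = a * m * (‖c‖ / 2) * ‖φ x‖ ^ 2 + a * ‖c‖ / (2 * m) * S := by
    field_simp
  rw [pohozaevDensity]
  linarith

theorem le_pohozaevDensity_two {a ω : ℝ} (ha : 0 < a) (hω : ω ≤ 0) {c : Space 2}
    (φ : Space 2 → ℂ) (g : Fin 2 → Space 2 → ℂ) (x : Space 2) :
    2 * ∑ j, ‖g j x‖ ^ 2 ≤ pohozaevDensity a ω c φ g x := by
  have := mul_nonneg (mul_nonneg ha.le (neg_nonneg.2 hω)) (sq_nonneg ‖φ x‖)
  rw [pohozaevDensity]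
  norm_num
  nlinarith

/-- If a density `D ≥ κ |∇ φ|²` with `κ > 0` has nonpositive integral, then `φ = 0`. -/
theorem HasWeakGrad.eq_zero_of_integral_nonpos (hN1 : 1 ≤ N) {φ : Space N → ℂ}
    {g : Fin N → Space N → ℂ} (h : HasWeakGrad φ g) {D : Space N → ℝ} {κ : ℝ} (hκ : 0 < κ)
    (hD : ∀ x, κ * ∑ j, ‖g j x‖ ^ 2 ≤ D x) (hi : Integrable D) (h0 : ∫ x, D x ≤ 0) :
    φ =ᵐ[volume] 0 := by
  have hS : ∀ x, 0 ≤ ∑ j, ‖g j x‖ ^ 2 := fun x => Finset.sum_nonneg fun _ _ => sq_nonneg _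
  have hD0 : ∀ x, 0 ≤ D x := fun x => (mul_nonneg hκ.le (hS x)).trans (hD x)
  have hz := (integral_eq_zero_iff_of_nonneg hD0 hi).1 (le_antisymm h0 (integral_nonneg hD0))
  refine h.eq_zero hN1 fun j => ?_
  filter_upwards [hz] with x hx
  have h1 : ∑ j, ‖g j x‖ ^ 2 = 0 := by
    have h2 := hD x
    rw [hx, Pi.zero_apply] at h2
    nlinarith [hS x]
  have h3 := (Finset.sum_eq_zero_iff_of_nonneg fun _ _ => sq_nonneg _).1 h1 j (Finset.mem_univ j)
  simpa using h3

/-- Coercivity of both Pohozaev densities excludes travelling solitary waves. -/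
theorem IsTravellingSolitaryWave.eq_zero (hN1 : 1 ≤ N) (hN3 : N ≤ 3) {γ ω : ℝ} {c : Space N}
    {φ ψ : Space N → ℂ} (hw : IsTravellingSolitaryWave γ ω c φ ψ) {κ₁ κ₂ : ℝ} (h₁ : 0 < κ₁)
    (h₂ : 0 < κ₂)
    (hc₁ : ∀ (φ : Space N → ℂ) (g : Fin N → Space N → ℂ) (x : Space N),
      κ₁ * ∑ j, ‖g j x‖ ^ 2 ≤ pohozaevDensity 1 ω c φ g x)
    (hc₂ : ∀ (φ : Space N → ℂ) (g : Fin N → Space N → ℂ) (x : Space N),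
      κ₂ * ∑ j, ‖g j x‖ ^ 2 ≤ pohozaevDensity γ (3 * ω) c φ g x) :
    φ =ᵐ[volume] 0 ∧ ψ =ᵐ[volume] 0 := by
  obtain ⟨hφ, hψ, hs⟩ := hw
  obtain ⟨g, hg⟩ := hφ.exists_hasWeakGrad
  obtain ⟨h, hh⟩ := hψ.exists_hasWeakGrad
  obtain ⟨i1, i2, h0⟩ := integral_pohozaev hN1 hN3 hg hh hs
  have n1 : 0 ≤ ∫ x, pohozaevDensity 1 ω c φ g x := integral_nonneg fun x =>
    (mul_nonneg h₁.le (Finset.sum_nonneg fun _ _ => sq_nonneg _)).trans (hc₁ φ g x)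
  have n2 : 0 ≤ ∫ x, pohozaevDensity γ (3 * ω) c ψ h x := integral_nonneg fun x =>
    (mul_nonneg h₂.le (Finset.sum_nonneg fun _ _ => sq_nonneg _)).trans (hc₂ ψ h x)
  exact ⟨hg.eq_zero_of_integral_nonpos hN1 h₁ (hc₁ φ g) i1 (by linarith),
    hh.eq_zero_of_integral_nonpos hN1 h₂ (hc₂ ψ h) i2 (by linarith)⟩

end Nonexistence

end NLSSystem

end

theorem theorem1p2 (N : ℕ) (hN1 : 1 ≤ N) (hN3 : N ≤ 3) (γ : ℝ) (hγ : 0 < γ)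
    (ω : ℝ) (c : NLSSystem.Space N)
    (h : (N = 2 ∧ ω ≤ 0) ∨
      ((N = 1 ∨ N = 3) ∧ ω ≤ -(‖c‖ / (2 * (N : ℝ))) ∧
        ‖c‖ < min (2 * (4 - (N : ℝ))) (6 / γ * (4 - (N : ℝ))))) :
    ¬ ∃ φ ψ : NLSSystem.Space N → ℂ,
      ¬ (φ =ᵐ[volume] 0 ∧ ψ =ᵐ[volume] 0) ∧
        NLSSystem.IsTravellingSolitaryWave γ ω c φ ψ := by
  rintro ⟨φ, ψ, hne, hw⟩
  refine hne ?_
  rcases h with ⟨rfl, hω⟩ | ⟨hN, hω, hc⟩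
  · exact hw.eq_zero hN1 hN3 two_pos two_pos
      (NLSSystem.le_pohozaevDensity_two one_pos hω)
      (NLSSystem.le_pohozaevDensity_two hγ (by linarith))
  · obtain ⟨hc1, hc2⟩ := lt_min_iff.1 hc
    have h1 := fun φ g x => NLSSystem.le_pohozaevDensity hN one_pos one_pos hω φ g x
    simp only [one_mul, mul_one] at h1
    refine hw.eq_zero hN1 hN3 ?_ ?_ h1
      (NLSSystem.le_pohozaevDensity hN hγ (by norm_num : (0 : ℝ) < 3) hω)
    · linarith
    · rw [div_mul_eq_mul_div, lt_div_iff₀ hγ] at hc2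
      linarith
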